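/- **Notation.** Let $q=e^{2\pi i\tau}$, $\operatorname{Im}\tau>0$, and $q^x:=e^{2\pi i\tau x}$. Let $\eta(\tau)=q^{1/24}\prod_{n\ge1}(1-q^n)$. For a positive integer $k$ and $j\in\mathbb Z$ let $\Theta_{j,k}(\tau,z)=\sum_{n\in\mathbb Z+j/2k}q^{kn^2}e^{2\pi iknz}$, and let $\vartheta_{00}=\Theta_{2,2}+\Theta_{0,2}$, $\vartheta_{01}=-\Theta_{2,2}+\Theta_{0,2}$, $\vartheta_{10}=\Theta_{1,2}+\Theta_{-1,2}$, $\vartheta_{11}=i\Theta_{1,2}-i\Theta_{-1,2}$. For an integer $m\ge0$ put $$\Phi^{[m]}(\tau,z_1,z_2,t)=e^{2\pi i(m+1)t}\sum_{j\in\mathbb Z}\left(\frac{e^{2\pi ij(m+1)(z_1+z_2)}q^{j^2(m+1)}}{1-e^{2\pi iz_1}q^j}-\frac{e^{-2\pi ij(m+1)(z_1+z_2)}q^{j^2(m+1)}}{1-e^{-2\pi iz_2}q^j}\right),$$ $$\tilde\Phi^{[m]}(\tau,z_1,z_2,t)=\Phi^{[m]}(\tau,z_1,z_2,t)-\tfrac12e^{2\pi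 i(m+1)t}\sum_{j\in\mathbb Z/(2m+2)\mathbb Z}R_{m+1;j}\!\left(\tau,\tfrac{z_1-z_2}2\right)\bigl(\Theta_{j,m+1}-\Theta_{-j,m+1}\bigr)(\tau,z_1+z_2),$$ where, for $m\ge 1$, with $E(x)=2\int_0^xe^{-\pi u^2}du$, $$R_{m;j}(\tau,v)=\sum_{n\in\mathbb Z,\ n\equiv j\bmod 2m}\left(\operatorname{sign}(n+\tfrac12)-E\!\left(\Bigl(n+2m\tfrac{\operatorname{Im}v}{\operatorname{Im}\tau}\Bigr)\Bigl(\tfrac{\operatorname{Im}\tau}m\Bigr)^{1/2}\right)\right)e^{-\frac{\pi in^2}{2m}\tau-2\pi inv}.$$ For $M\ge1$, $\epsilon,\epsilon'\in\{0,\frac12\}$ and $j,k\in\epsilon'+\mathbb Z$ put $$\tilde\Psi^{[M,m;\epsilon]}_{j,k;\epsilon'}(\tau,z_1,z_2,t)=q^{\frac{(m+1)jk}M}e^{\frac{2\pi i(m+1)}M(kz_1+jz_2)}\,\tilde\Phi^{[m]}\!\left(M\tau,z_1+j\tau+\epsilon,z_2+k\tau+\epsilon,\tfrac tM\right).$$ Let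 $D_1=\frac1{2\pi i}\left(\frac\partial{\partial z_1}-\frac\partial{\partial z_2}-\frac{z_1-z_2}{2\tau}\frac\partial{\partial t}\right)$ (for non-holomorphic functions, $\frac\partial{\partial z}=\frac12(\frac\partial{\partial x}-i\frac\partial{\partial y})$), and let $$\hat R^{(\epsilon)}_{\epsilon'}(\tau,z_1,z_2)=(-1)^{2\epsilon'}\eta(\tau)^4\frac{\vartheta_{11}(\tau,z_1-z_2)\,\vartheta_{11}(\tau,z_1+z_2)}{\vartheta_{1-2\epsilon',1-2\epsilon}(\tau,z_1)^2\,\vartheta_{1-2\epsilon',1-2\epsilon}(\tau,z_2)^2}$$ be the normalized affine denominators of $\hat A_{1|1}$. For an integer $m\ge1$, the modified normalized characters ($\epsilon=\frac12$) and supercharacters ($\epsilon=0$), untwisted ($\epsilon'=0$) and twisted ($\epsilon'=\frac12$), of the admissible $\hat A_{1|1}$-modules of level $-\frac mM$ are the functions $$\tilde{\mathrm{ch}}^{A_{1|1}[M,-m;\epsilon]}_{j,k;\epsilon'}(\tau,z_1,z_2,t)=\frac{\bigl(D_1\tilde\Psi^{[M,m-1;\epsilon]}_{j,-k;\epsilon'}\bigr)(\tau,z_1,z_2,-t)}{\hat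 R^{(\epsilon)}_{\epsilon'}(\tau,z_1,z_2)},\qquad j,k\in\epsilon'+\mathbb Z;$$ the modules are indexed by $$\Omega^{A_{1|1}}_{\epsilon'}=\{(j,k)\mid j,k\in\epsilon'+\mathbb Z,\ 0\le j<M,\ -\tfrac12\le k<M-\tfrac12\}.$$ **Theorem 8.7.** Let $M$ and $m$ be positive integers such that $\gcd(M,2m)=1$ if $m>1$. Let $\epsilon,\epsilon'\in\{0,\frac12\}$ and $(j,k)\in\Omega^{A_{1|1}}_{\epsilon'}$. Let $\operatorname{Im}\tau>0$, $t\in\mathbb C$, and let $z_1,z_2\in\mathbb C$ be such that $z_1,z_2\notin\epsilon'+\epsilon\tau+\mathbb Z+\mathbb Z\tau$ and $z_1\pm z_2\notin\mathbb Z+\mathbb Z\tau$ (so that the functions below are regular). Then $$\tilde{\mathrm{ch}}^{A_{1|1}[M,-m;\epsilon]}_{j,k;\epsilon'}\!\left(-\frac1\tau,\frac{z_1}\tau,\frac{z_2}\tau,t+\frac{z_1z_2}\tau\right)=(-1)^{2(\epsilon-\epsilon')}\frac\tau{iM}\sum_{a,b\in\epsilon+\mathbb Z/M\mathbb Z}e^{\frac{2\pi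 im}M(ak+bj)}\,\tilde{\mathrm{ch}}^{A_{1|1}[M,-m;\epsilon']}_{a,b;\epsilon}(\tau,z_1,z_2,t).$$ Here each summand on the right depends only on the classes of $a$ and $b$ modulo $M$, so that the sum may be taken over $(a,b)\in\Omega^{A_{1|1}}_{\epsilon}$; and the functions $\tilde\Psi^{[M,m-1;\epsilon']}_{a,-b;\epsilon}(\tau,\cdot,\cdot,\cdot)$, $a,b\in\epsilon+\mathbb Z$, are real differentiable at $(z_1,z_2,-t)$. -/

import Mathlib

namespace MockA11

open Complex

/-- The two values `0` and `1/2` of the superscript `ε` (`0`: supercharacters, `1/2`: characters)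
and of the subscript `ε'` (`0`: untwisted, `1/2`: twisted), encoded by `e : Fin 2`, `ε = e/2`. -/
def half (e : Fin 2) : ℚ := ((e : ℕ) : ℚ) / 2

/-- `q ^ x = exp (2 π i τ x)` where `q = exp (2 π i τ)`. -/
noncomputable def qPow (τ x : ℂ) : ℂ := exp (2 * Real.pi * I * τ * x)

/-- The degree `k` theta function
`Θ_{j,k}(τ,z) = ∑_{n ∈ ℤ + j/(2k)} q^{k n²} e^{2 π i k n z}`. -/
noncomputable def Theta (j : ℤ) (k : ℕ) (τ z : ℂ) : ℂ :=
  ∑' n : ℤ, qPow τ (k * ((n : ℂ) + (j : ℂ) / (2 * k)) ^ 2) *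
    exp (2 * Real.pi * I * k * ((n : ℂ) + (j : ℂ) / (2 * k)) * z)

/-- The four Jacobi theta functions `ϑ_{ab}`, `a, b ∈ {0, 1}`. -/
noncomputable def vartheta (a b : Fin 2) (τ z : ℂ) : ℂ :=
  match a, b with
  | 0, 0 => Theta 2 2 τ z + Theta 0 2 τ z
  | 0, 1 => -Theta 2 2 τ z + Theta 0 2 τ z
  | 1, 0 => Theta 1 2 τ z + Theta (-1) 2 τ z
  | 1, 1 => I * Theta 1 2 τ z - I * Theta (-1) 2 τ z

/-- The normalized affine denominators `R̂^{(ε)}_{ε'}(τ,z₁,z₂)` of the affine Lie superalgebra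
`Â_{1|1}`, with `ε = e/2`, `ε' = e'/2`:
`(-1)^{2ε'} η(τ)⁴ ϑ₁₁(τ,z₁-z₂) ϑ₁₁(τ,z₁+z₂) / (ϑ_{1-2ε',1-2ε}(τ,z₁)² ϑ_{1-2ε',1-2ε}(τ,z₂)²)`. -/
noncomputable def Rhat (e e' : Fin 2) (τ z₁ z₂ : ℂ) : ℂ :=
  (-1) ^ (e' : ℕ) * ModularForm.eta τ ^ 4 *
    (vartheta 1 1 τ (z₁ - z₂) * vartheta 1 1 τ (z₁ + z₂)) /
    (vartheta (1 - e') (1 - e) τ z₁ ^ 2 * vartheta (1 - e') (1 - e) τ z₂ ^ 2)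

/-- The mock theta function `Φ^{[m]}`. -/
noncomputable def Phi (m : ℕ) (τ z₁ z₂ t : ℂ) : ℂ :=
  exp (2 * Real.pi * I * (m + 1) * t) *
    ∑' j : ℤ,
      (exp (2 * Real.pi * I * j * (m + 1) * (z₁ + z₂)) * qPow τ ((j : ℂ) ^ 2 * (m + 1)) /
          (1 - exp (2 * Real.pi * I * z₁) * qPow τ j) -
        exp (-(2 * Real.pi * I * j * (m + 1) * (z₁ + z₂))) * qPow τ ((j : ℂ) ^ 2 * (m + 1)) /
          (1 - exp (-(2 * Real.pi * I * z₂)) * qPow τ j))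

/-- The odd entire function `E(x) = 2 ∫₀ˣ e^{-π u²} du` (on the real line). -/
noncomputable def zwegersE (x : ℝ) : ℝ := 2 * ∫ u in (0 : ℝ)..x, Real.exp (-Real.pi * u ^ 2)

/-- The term of index `n` of the series defining Zwegers' function `R_{m;j}`. -/
noncomputable def zwegersTerm (m : ℕ) (n : ℤ) (τ v : ℂ) : ℂ :=
  ((Real.sign ((n : ℝ) + 1 / 2) -
      zwegersE (((n : ℝ) + 2 * m * (v.im / τ.im)) * Real.sqrt (τ.im / m)) : ℝ) : ℂ) *
    exp (-(Real.pi * I * (n : ℂ) ^ 2 / (2 * m)) * τ - 2 * Real.pi * I * n * v)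

/-- Zwegers' real analytic function `R_{m;j}(τ,v)`, a sum over all integers `n ≡ j mod 2m`. -/
noncomputable def zwegersR (m : ℕ) (j : ℤ) (τ v : ℂ) : ℂ :=
  ∑' l : ℤ, zwegersTerm m (j + 2 * m * l) τ v

/-- The correction `Φ^{[m]}_add`; the summation is over residues `j` modulo `2m+2`. -/
noncomputable def PhiAdd (m : ℕ) (τ z₁ z₂ t : ℂ) : ℂ :=
  -(1 / 2) * exp (2 * Real.pi * I * (m + 1) * t) *
    ∑ j ∈ Finset.range (2 * m + 2),
      zwegersR (m + 1) (j : ℤ) τ ((z₁ - z₂) / 2) *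
        (Theta (j : ℤ) (m + 1) τ (z₁ + z₂) - Theta (-(j : ℤ)) (m + 1) τ (z₁ + z₂))

/-- The non-meromorphic modification `Φ̃^{[m]} = Φ^{[m]} + Φ^{[m]}_add`. -/
noncomputable def PhiTilde (m : ℕ) (τ z₁ z₂ t : ℂ) : ℂ :=
  Phi m τ z₁ z₂ t + PhiAdd m τ z₁ z₂ t

/-- `Ψ̃^{[M,m;ε]}_{j,k;ε'}`, `ε = e/2`; the subscript `ε'` only records that `j, k ∈ ε' + ℤ`. -/
noncomputable def PsiTilde (M m : ℕ) (e : Fin 2) (j k : ℚ) (τ z₁ z₂ t : ℂ) : ℂ :=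
  qPow τ ((m + 1) * j * k / M) *
    exp (2 * Real.pi * I * (m + 1) / M * (k * z₁ + j * z₂)) *
    PhiTilde m (M * τ) (z₁ + j * τ + (half e : ℂ)) (z₂ + k * τ + (half e : ℂ)) (t / M)

/-- The Wirtinger derivative `∂/∂z = (∂/∂x - i ∂/∂y) / 2` of a function of `z = x + i y`. -/
noncomputable def dz (f : ℂ → ℂ) (z : ℂ) : ℂ :=
  1 / 2 * (fderiv ℝ f z 1 - I * fderiv ℝ f z I)

/-- The operator `D₁ = (1/2πi) (∂/∂z₁ - ∂/∂z₂ - ((z₁-z₂)/2τ) ∂/∂t)`. -/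
noncomputable def D₁ (F : ℂ → ℂ → ℂ → ℂ → ℂ) (τ z₁ z₂ t : ℂ) : ℂ :=
  1 / (2 * Real.pi * I) *
    (dz (fun w => F τ w z₂ t) z₁ - dz (fun w => F τ z₁ w t) z₂ -
      (z₁ - z₂) / (2 * τ) * dz (fun w => F τ z₁ z₂ w) t)

/-- The modified normalized (super)characters of level `-m/M`, `m ≥ 1`, untwisted and twisted:
`R̂^{(ε)}_{ε'} · c̃h^{[M,-m;ε]}_{j,k;ε'} (τ,z₁,z₂,t) = (D₁ Ψ̃^{[M,m-1;ε]}_{j,-k;ε'}) (τ,z₁,z₂,-t)`,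
with `D₁` applied before `t` is replaced by `-t`. -/
noncomputable def modChar (M m : ℕ) (e e' : Fin 2) (j k : ℚ) (τ z₁ z₂ t : ℂ) : ℂ :=
  D₁ (PsiTilde M (m - 1) e j (-k)) τ z₁ z₂ (-t) / Rhat e e' τ z₁ z₂

/-- The set `Ω_{ε'}` indexing the modified (super)characters; see `mem_Omega`. -/
def Omega (M : ℕ) (e' : Fin 2) : Finset (ℚ × ℚ) :=
  (Finset.range M ×ˢ Finset.range M).image
    fun p => ((p.1 : ℚ) + half e', (p.2 : ℚ) - half e')

/-- `Ω_{ε'} = {(j,k) | j, k ∈ ε' + ℤ, 0 ≤ j < M, -1/2 ≤ k < M - 1/2}`. -/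
theorem mem_Omega (M : ℕ) (e' : Fin 2) (j k : ℚ) :
    (j, k) ∈ Omega M e' ↔
      (∃ n : ℤ, j = half e' + n) ∧ (∃ n : ℤ, k = half e' + n) ∧
        (0 ≤ j ∧ j < M) ∧ (-(1 / 2) ≤ k ∧ k < M - 1 / 2) := by
  have he : half e' = 0 ∧ (e' : ℕ) = 0 ∨ half e' = 1 / 2 ∧ (e' : ℕ) = 1 := by
    fin_cases e' <;> simp [half]
  simp only [Omega, Finset.mem_image, Finset.mem_product, Finset.mem_range, Prod.mk.injEq,
    Prod.exists]
  constructor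
  · rintro ⟨a, b, ⟨ha, hb⟩, rfl, rfl⟩
    have ha' : (a : ℚ) + 1 ≤ M := by
      have := Nat.succ_le_of_lt ha
      exact_mod_cast this
    have hb' : (b : ℚ) + 1 ≤ M := by
      have := Nat.succ_le_of_lt hb
      exact_mod_cast this
    have ha0 : (0 : ℚ) ≤ a := by positivity
    have hb0 : (0 : ℚ) ≤ b := by positivity
    refine ⟨⟨a, by push_cast; ring⟩, ⟨b - (e' : ℕ), by simp only [half]; push_cast; ring⟩, ?_⟩
    rcases he with ⟨h, -⟩ | ⟨h, -⟩ <;> rw [h] <;> refine ⟨⟨?_, ?_⟩, ?_, ?_⟩ <;> linarith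
  · rintro ⟨⟨x, rfl⟩, ⟨y, rfl⟩, ⟨h1, h2⟩, h3, h4⟩
    have key : (-1 : ℚ) < x ∧ (x : ℚ) < M ∧ (-1 : ℚ) < y + (e' : ℕ) ∧
        (y : ℚ) + (e' : ℕ) < M := by
      rcases he with ⟨h, h'⟩ | ⟨h, h'⟩ <;> rw [h] at h1 h2 h3 h4 <;> rw [h'] <;> push_cast <;>
        refine ⟨?_, ?_, ?_, ?_⟩ <;> linarith
    obtain ⟨k1, k2, k3, k4⟩ := key
    have k1' : (-1 : ℤ) < x := by exact_mod_cast k1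
    have k2' : x < (M : ℤ) := by exact_mod_cast k2
    have k3' : (-1 : ℤ) < y + (e' : ℕ) := by exact_mod_cast k3
    have k4' : y + (e' : ℕ) < (M : ℤ) := by exact_mod_cast k4
    obtain ⟨a, ha⟩ := Int.eq_ofNat_of_zero_le (show 0 ≤ x by omega)
    obtain ⟨b, hb⟩ := Int.eq_ofNat_of_zero_le (show 0 ≤ y + (e' : ℕ) by omega)
    refine ⟨a, b, ⟨by omega, by omega⟩, by rw [ha]; push_cast; ring, ?_⟩
    have hb' : (b : ℚ) = y + (e' : ℕ) := by exact_mod_cast hb.symm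
    rw [hb']
    simp only [half]
    ring

/-- The points `(τ,z₁,z₂)` at which the numerators and denominators of the functions
`modChar M m e e' j k` (with `j, k ∈ ε' + ℤ`) have no singularity and the denominator
`Rhat e e'` does not vanish: the theta functions in `Rhat e e'` vanish exactly at the
excluded points. -/
def IsRegularPoint (e e' : Fin 2) (τ z₁ z₂ : ℂ) : Prop :=
  ∀ r s : ℤ,
    z₁ ≠ (half e : ℂ) + r + ((half e' : ℂ) + s) * τ ∧
    z₂ ≠ (half e : ℂ) + r + ((half e' : ℂ) + s) * τ ∧
    z₁ - z₂ ≠ r + s * τ ∧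
    z₁ + z₂ ≠ r + s * τ

end MockA11

namespace MockA11

open Complex ComplexConjugate

/-! ### The error function `zwegersE` -/

/-! The modified function Φ̃ is, up to explicit exponentials, a doubly periodic object: a series ∑_w
e^{κ(w z̄₂ − w̄ z₂ − |z₁+w|²)}/(z₁+w) over a lattice (a Gaussian Kronecker series), plus the same
series with z₁, z₂ exchanged. For such series modular behaviour is plain, because a sum over a
lattice does not depend on the basis.

The bridge is `row_identity`: for a fixed row of the lattice, a geometric term completed by error
functions equals a Gaussian-regularized cotangent series. Both sides are functions of an auxiliary
real V. Poisson summation shows that their V-derivatives agree, so their difference is constant; but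
it is multiplied by e^{2πiζ} ≠ 1 when V moves by a period, so it vanishes. Summing over rows, and
unfolding Zwegers' R times theta functions into a double series, gives `PhiTilde_eq`.

For Ψ̃ the lattice is ℤMτ+ℤ. Under τ ↦ −1/τ and rescaling by τ it becomes ℤτ+ℤM. Both have index M
in ℤτ+ℤ, and `kernelSum_isogeny` passes between them: one sum over residues glues cosets together,
the other is a character sum, which needs M coprime to the index. This yields the finite Fourier sum
of `PsiTilde_neg_inv`.

Finally, the direction of D₁ is mapped by the substitution (z₁,z₂,t) ↦ (τz₁, τz₂, t+τz₁z₂) to τ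
times itself, and Wirtinger derivatives commute with holomorphic substitutions, so D₁Ψ̃ obeys the
same law with one more factor τ. Dividing by the inversion law `Rhat_neg_inv` of the denominators,
of factor ±iτ, leaves ±τ/(iM). -/

theorem hasDerivAt_zwegersE (x : ℝ) :
    HasDerivAt zwegersE (2 * Real.exp (-Real.pi * x ^ 2)) x := by
  have hc : Continuous fun u : ℝ => Real.exp (-Real.pi * u ^ 2) := by fun_prop
  exact (intervalIntegral.integral_hasDerivAt_right (hc.intervalIntegrable _ _)
    (hc.stronglyMeasurableAtFilter _ _) hc.continuousAt).const_mul 2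

theorem zwegersE_neg (x : ℝ) : zwegersE (-x) = -zwegersE x := by
  have h := intervalIntegral.integral_comp_neg (a := 0) (b := x)
    (fun u : ℝ => Real.exp (-Real.pi * u ^ 2))
  simp only [neg_sq, neg_zero] at h
  rw [zwegersE, zwegersE, h, intervalIntegral.integral_symm]
  ring

theorem tendsto_zwegersE_atTop :
    Filter.Tendsto zwegersE Filter.atTop (nhds 1) := by
  have h := MeasureTheory.intervalIntegral_tendsto_integral_Ioi (μ := MeasureTheory.volume) 0
    (integrable_exp_neg_mul_sq Real.pi_pos).integrableOn Filter.tendsto_id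
  rw [integral_gaussian_Ioi, div_self Real.pi_ne_zero, Real.sqrt_one] at h
  have h2 := h.const_mul 2
  rw [mul_one_div_cancel two_ne_zero] at h2
  exact h2

theorem strictMono_zwegersE : StrictMono zwegersE :=
  strictMono_of_deriv_pos fun x => by
    rw [(hasDerivAt_zwegersE x).deriv]
    positivity

theorem zwegersE_le_one (x : ℝ) : zwegersE x ≤ 1 :=
  strictMono_zwegersE.monotone.ge_of_tendsto tendsto_zwegersE_atTop x

theorem neg_one_le_zwegersE (x : ℝ) : -1 ≤ zwegersE x := by
  have := zwegersE_le_one (-x)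
  rw [zwegersE_neg] at this
  linarith

theorem zwegersE_sub_le {x X : ℝ} (hx : 0 ≤ x) (hX : x ≤ X) :
    zwegersE X - zwegersE x ≤ Real.exp (-Real.pi * x ^ 2) * zwegersE (X - x) := by
  have hc : Continuous fun u : ℝ => Real.exp (-Real.pi * u ^ 2) := by fun_prop
  have hc' : Continuous fun u : ℝ => Real.exp (-Real.pi * (u + x) ^ 2) := by fun_prop
  have h1 := intervalIntegral.integral_interval_sub_left (hc.intervalIntegrable 0 X)
    (hc.intervalIntegrable 0 x) (μ := MeasureTheory.volume)
  have h2 := intervalIntegral.integral_comp_add_right (a := 0) (b := X - x)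
    (fun u : ℝ => Real.exp (-Real.pi * u ^ 2)) x
  have h3 : ∫ u in (0 : ℝ)..(X - x), Real.exp (-Real.pi * (u + x) ^ 2) ≤
      ∫ u in (0 : ℝ)..(X - x), Real.exp (-Real.pi * x ^ 2) * Real.exp (-Real.pi * u ^ 2) := by
    refine intervalIntegral.integral_mono_on (by linarith) (hc'.intervalIntegrable _ _)
      ((hc.const_mul _).intervalIntegrable _ _) fun u hu => ?_
    rw [← Real.exp_add, Real.exp_le_exp]
    -- Here (u + x)² ≥ x² + u², the cross term being nonnegative.
    nlinarith [Real.pi_pos, mul_nonneg hu.1 hx, mul_nonneg Real.pi_pos.le (mul_nonneg hu.1 hx)]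
  rw [intervalIntegral.integral_const_mul, h2] at h3
  simp only [zero_add, sub_add_cancel] at h3
  simp only [zwegersE]
  linarith

theorem one_sub_zwegersE_le {x : ℝ} (hx : 0 ≤ x) :
    1 - zwegersE x ≤ Real.exp (-Real.pi * x ^ 2) := by
  refine le_of_tendsto (tendsto_zwegersE_atTop.sub_const (zwegersE x)) ?_
  filter_upwards [Filter.eventually_ge_atTop x] with X hX
  refine (zwegersE_sub_le hx hX).trans ?_
  have := zwegersE_le_one (X - x)
  have h := Real.exp_pos (-Real.pi * x ^ 2)
  nlinarith

/-- The coefficient of Zwegers' series: a sign minus its smooth approximation. -/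
noncomputable def signDefect (n : ℤ) (x : ℝ) : ℝ := Real.sign ((n : ℝ) + 1 / 2) - zwegersE x

theorem sign_intCast_add_half (n : ℤ) :
    Real.sign ((n : ℝ) + 1 / 2) = if 0 ≤ n then 1 else -1 := by
  split_ifs with h
  · have : (0 : ℝ) ≤ n := by exact_mod_cast h
    exact Real.sign_of_pos (by linarith)
  · have : (n : ℝ) + 1 ≤ 0 := by exact_mod_cast (by omega : n + 1 ≤ 0)
    exact Real.sign_of_neg (by linarith)

/-- If n and n + c have the same sign, the defect is a Gaussian tail and (n+c)² = 3n²/4 − 3c² +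
(n/2+2c)². Otherwise |n| ≤ |c|, and the trivial bound 2 suffices. The rate 3/4 must exceed 1/2, the
rate at which the exponentials in Zwegers' series grow. -/
theorem abs_signDefect_le {Y : ℝ} (hY : 0 < Y) (n : ℤ) (c : ℝ) :
    |signDefect n ((n + c) * √Y)| ≤
      2 * Real.exp (3 * Real.pi * Y * c ^ 2) * Real.exp (-Real.pi * (3 / 4 * Y * n ^ 2)) := by
  have hπ := Real.pi_pos
  have hs : 0 ≤ √Y := Real.sqrt_nonneg Y
  have hsq : ((n + c) * √Y) ^ 2 = (n + c) ^ 2 * Y := by rw [mul_pow, Real.sq_sqrt hY.le]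
  have hE1 := zwegersE_le_one ((n + c) * √Y)
  have hE2 := neg_one_le_zwegersE ((n + c) * √Y)
  rw [mul_assoc, ← Real.exp_add]
  have hb : Real.exp (-Real.pi * ((n + c) * √Y) ^ 2) ≤
      Real.exp (3 * Real.pi * Y * c ^ 2 + -Real.pi * (3 / 4 * Y * n ^ 2)) := by
    rw [Real.exp_le_exp, hsq]
    have : 0 ≤ Real.pi * Y * ((n : ℝ) / 2 + 2 * c) ^ 2 := by positivity
    nlinarith
  have hp := Real.exp_pos (3 * Real.pi * Y * c ^ 2 + -Real.pi * (3 / 4 * Y * n ^ 2))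
  have htriv : (n : ℝ) ^ 2 ≤ c ^ 2 →
      1 ≤ Real.exp (3 * Real.pi * Y * c ^ 2 + -Real.pi * (3 / 4 * Y * n ^ 2)) := fun h => by
    rw [Real.one_le_exp_iff]
    have : 0 ≤ Real.pi * Y * (c ^ 2 - (n : ℝ) ^ 2) := by
      have : 0 ≤ c ^ 2 - (n : ℝ) ^ 2 := by linarith
      positivity
    have : 0 ≤ Real.pi * Y * c ^ 2 := by positivity
    nlinarith
  rw [signDefect, sign_intCast_add_half]
  split_ifs with h
  · have hn : (0 : ℝ) ≤ n := by exact_mod_cast h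
    rw [abs_of_nonneg (by linarith)]
    rcases le_total 0 ((n : ℝ) + c) with h0 | h0
    · have := one_sub_zwegersE_le (mul_nonneg h0 hs)
      linarith
    · have := htriv (by nlinarith)
      linarith
  · have hn : (n : ℝ) ≤ 0 := by exact_mod_cast (by omega : n ≤ 0)
    rw [abs_of_nonpos (by linarith)]
    rcases le_total 0 ((n : ℝ) + c) with h0 | h0
    · have := htriv (by nlinarith)
      linarith
    · have := one_sub_zwegersE_le (x := -((n + c) * √Y))
        (by nlinarith)
      rw [zwegersE_neg, neg_sq] at this
      linarith

/-! ### The row identity -/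

theorem norm_exp_neg_two_pi_I_int_mul_le (n : ℤ) (ζ : ℂ) :
    ‖exp (-(2 * Real.pi * I * n * ζ))‖ ≤ Real.exp (2 * Real.pi * |ζ.im| * |(n : ℝ)|) := by
  rw [norm_exp, Real.exp_le_exp]
  have : (-(2 * Real.pi * I * n * ζ)).re = 2 * Real.pi * (n * ζ.im) := by
    rw [show (-(2 * Real.pi * I * n * ζ) : ℂ) = ((-(2 * Real.pi * n) : ℝ) : ℂ) * (I * ζ) by
      push_cast; ring, re_ofReal_mul]
    simp
    ring
  rw [this, mul_assoc (2 * Real.pi), mul_comm |ζ.im|, ← abs_mul]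
  exact mul_le_mul_of_nonneg_left (le_abs_self _) (by positivity)

theorem summable_gaussian_mul_exp {T : ℝ} (hT : 0 < T) (S C : ℝ) :
    Summable fun n : ℤ => C * Real.exp (-Real.pi * (T * n ^ 2)) *
      Real.exp (2 * Real.pi * S * |(n : ℝ)|) := by
  convert! (summable_pow_mul_jacobiTheta₂_term_bound S hT 0).mul_left C using 2 with n
  rw [mul_assoc, ← Real.exp_add, pow_zero, one_mul]
  congr 2
  push_cast
  ring

/-- The completed part of the row function. -/
noncomputable def defectTerm (Y V : ℝ) (ζ : ℂ) (n : ℤ) : ℂ :=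
  (signDefect n ((n + V / Y) * √Y) : ℂ) * exp (-(2 * Real.pi * I * n * ζ))

/-- The terms of the Gaussian-regularized cotangent series. -/
noncomputable def rowTerm (Y V : ℝ) (ζ : ℂ) (b : ℤ) : ℂ :=
  exp (-(Real.pi / Y) * ((ζ + b) ^ 2 - 2 * I * V * (ζ + b))) / (ζ + b)

theorem norm_defectTerm_le {Y : ℝ} (hY : 0 < Y) (V : ℝ) (ζ : ℂ) (n : ℤ) :
    ‖defectTerm Y V ζ n‖ ≤ 2 * Real.exp (3 * Real.pi * Y * (V / Y) ^ 2) *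
      Real.exp (-Real.pi * (3 / 4 * Y * n ^ 2)) * Real.exp (2 * Real.pi * |ζ.im| * |(n : ℝ)|) := by
  rw [defectTerm, norm_mul, norm_real, Real.norm_eq_abs]
  exact mul_le_mul (abs_signDefect_le hY n _) (norm_exp_neg_two_pi_I_int_mul_le n ζ)
    (norm_nonneg _) (by positivity)

theorem summable_defectTerm {Y : ℝ} (hY : 0 < Y) (V : ℝ) (ζ : ℂ) :
    Summable (defectTerm Y V ζ) :=
  .of_norm_bounded (summable_gaussian_mul_exp (by positivity) _ _) (norm_defectTerm_le hY V ζ)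

theorem hasDerivAt_defectTerm {Y : ℝ} (hY : 0 < Y) (V : ℝ) (ζ : ℂ) (n : ℤ) :
    HasDerivAt (fun V => defectTerm Y V ζ n)
      ((-(2 * (Real.exp (-Real.pi * (Y * (n + V / Y) ^ 2)) * (√Y / Y))) : ℝ) *
        exp (-(2 * Real.pi * I * n * ζ))) V := by
  have h1 : HasDerivAt (fun V : ℝ => (n + V / Y) * √Y) (1 / Y * √Y) V :=
    (((hasDerivAt_id V).div_const Y).const_add _).mul_const _
  have h2 := (((hasDerivAt_zwegersE _).comp V h1).const_sub (Real.sign ((n : ℝ) + 1 / 2)))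
  have h3 := (h2.ofReal_comp).mul_const (exp (-(2 * Real.pi * I * n * ζ)))
  refine h3.congr_deriv ?_
  congr 2
  rw [mul_pow, Real.sq_sqrt hY.le]
  ring_nf

theorem norm_deriv_defectTerm_le {Y : ℝ} (hY : 0 < Y) {V B : ℝ} (hV : |V| < B) (ζ : ℂ) (n : ℤ) :
    ‖((-(2 * (Real.exp (-Real.pi * (Y * (n + V / Y) ^ 2)) * (√Y / Y))) : ℝ) *
        exp (-(2 * Real.pi * I * n * ζ)) : ℂ)‖ ≤
      2 * (√Y / Y) * Real.exp (3 * Real.pi * Y * (B / Y) ^ 2) *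
      Real.exp (-Real.pi * (3 / 4 * Y * n ^ 2)) * Real.exp (2 * Real.pi * |ζ.im| * |(n : ℝ)|) := by
  have hs : 0 ≤ √Y := Real.sqrt_nonneg Y
  rw [norm_mul, norm_real, Real.norm_eq_abs, abs_neg, abs_of_nonneg (by positivity)]
  refine mul_le_mul ?_ (norm_exp_neg_two_pi_I_int_mul_le n ζ) (norm_nonneg _) (by positivity)
  rw [mul_assoc (2 * (√Y / Y)), ← Real.exp_add, mul_comm (Real.exp _), ← mul_assoc]
  refine mul_le_mul_of_nonneg_left (Real.exp_le_exp.mpr ?_) (by positivity)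
  have hVB : (V / Y) ^ 2 ≤ (B / Y) ^ 2 := by
    rw [div_pow, div_pow]
    gcongr 1
    exact sq_le_sq' (by linarith [abs_lt.mp hV]) (by linarith [abs_lt.mp hV])
  have h1 : 0 ≤ Real.pi * Y * ((n : ℝ) / 2 + 2 * (V / Y)) ^ 2 := by positivity
  have h2 : 0 ≤ Real.pi * Y * ((B / Y) ^ 2 - (V / Y) ^ 2) := by
    have : 0 ≤ (B / Y) ^ 2 - (V / Y) ^ 2 := by linarith
    have := Real.pi_pos
    positivity
  nlinarith

theorem norm_exp_row {Y : ℝ} (V : ℝ) (ζ : ℂ) (b : ℤ) :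
    ‖exp (-(Real.pi / Y) * ((ζ + b) ^ 2 - 2 * I * V * (ζ + b)))‖ =
      Real.exp (-(Real.pi / Y) * ((ζ.re + b) ^ 2 - ζ.im ^ 2 + 2 * V * ζ.im)) := by
  rw [norm_exp]
  congr 1
  rw [show (-(Real.pi / Y : ℂ)) = ((-(Real.pi / Y) : ℝ) : ℂ) by push_cast; ring, re_ofReal_mul]
  congr 1
  simp [pow_two]

theorem norm_exp_row_le {Y : ℝ} (hY : 0 < Y) {V B : ℝ} (hV : |V| < B) (ζ : ℂ) (b : ℤ) :
    ‖exp (-(Real.pi / Y) * ((ζ + b) ^ 2 - 2 * I * V * (ζ + b)))‖ ≤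
      Real.exp (Real.pi / Y * (ζ.re ^ 2 + ζ.im ^ 2 + 2 * B * |ζ.im|)) *
        Real.exp (-Real.pi * (1 / (2 * Y) * b ^ 2)) * Real.exp (2 * Real.pi * 0 * |(b : ℝ)|) := by
  rw [norm_exp_row, mul_zero, zero_mul, Real.exp_zero, mul_one, ← Real.exp_add, Real.exp_le_exp]
  have h1 : -(V * ζ.im) ≤ B * |ζ.im| := by
    refine (neg_le_abs _).trans ?_
    rw [abs_mul]
    gcongr
  have h2 : 0 ≤ Real.pi / Y * ((B * |ζ.im| + V * ζ.im) * 2 + ((b : ℝ) + 2 * ζ.re) ^ 2 / 2) := by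
    have : 0 ≤ B * |ζ.im| + V * ζ.im := by linarith
    have := Real.pi_pos
    positivity
  have h3 : -Real.pi * (1 / (2 * Y) * (b : ℝ) ^ 2) = Real.pi / Y * (-(b : ℝ) ^ 2 / 2) := by
    field_simp
  rw [h3]
  linarith

theorem summable_exp_row {Y : ℝ} (hY : 0 < Y) (V : ℝ) (ζ : ℂ) :
    Summable fun b : ℤ => exp (-(Real.pi / Y) * ((ζ + b) ^ 2 - 2 * I * V * (ζ + b))) :=
  .of_norm_bounded (summable_gaussian_mul_exp (by positivity) _ _)
    (norm_exp_row_le hY (lt_add_one |V|) ζ)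

theorem summable_rowTerm {Y : ℝ} (hY : 0 < Y) (V : ℝ) {ζ : ℂ} {δ : ℝ} (hδ : 0 < δ)
    (hζ : ∀ b : ℤ, δ ≤ ‖ζ + b‖) : Summable (rowTerm Y V ζ) := by
  refine .of_norm_bounded ((summable_exp_row hY V ζ).norm.mul_right δ⁻¹) fun b => ?_
  rw [rowTerm, norm_div, div_eq_mul_inv]
  gcongr
  exact hζ b

theorem hasDerivAt_rowTerm (Y V : ℝ) {ζ : ℂ} {b : ℤ} (hζ : ζ + b ≠ 0) :
    HasDerivAt (fun V => rowTerm Y V ζ b)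
      (2 * Real.pi * I / Y * exp (-(Real.pi / Y) * ((ζ + b) ^ 2 - 2 * I * V * (ζ + b)))) V := by
  have h1 : HasDerivAt (fun V : ℝ => -(Real.pi / Y : ℂ) * ((ζ + b) ^ 2 - 2 * I * V * (ζ + b)))
      (-(Real.pi / Y : ℂ) * -(2 * I * 1 * (ζ + b))) V :=
    ((((hasDerivAt_id V).ofReal_comp.const_mul (2 * I)).mul_const _).const_sub _).const_mul _
  refine (h1.cexp.div_const (ζ + b)).congr_deriv ?_
  field_simp

/-- Poisson summation: the derivatives in `V` of the two sides of the row identity agree. -/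
theorem tsum_gaussian_eq {Y : ℝ} (hY : 0 < Y) (V : ℝ) (ζ : ℂ) :
    ∑' n : ℤ, ((-(2 * (Real.exp (-Real.pi * (Y * (n + V / Y) ^ 2)) * (√Y / Y))) : ℝ) *
        exp (-(2 * Real.pi * I * n * ζ)) : ℂ) =
      -(2 / Y) * ∑' b : ℤ, exp (-(Real.pi / Y) * ((ζ + b) ^ 2 - 2 * I * V * (ζ + b))) := by
  have hYc : (Y : ℂ) ≠ 0 := by exact_mod_cast hY.ne'
  -- Expanding Y(n + V/Y)², the linear term 2Vn joins 2πinζ to give the parameter −(V + iζ).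
  have hP := Complex.tsum_exp_neg_quadratic (a := Y) (by simpa using hY) (-(V + I * ζ))
  have hsq : (Y : ℂ) ^ (1 / 2 : ℂ) = (√Y : ℝ) := by
    rw [Real.sqrt_eq_rpow, ofReal_cpow hY.le]
    norm_num
  have hs : ((√Y : ℝ) : ℂ) ≠ 0 := by exact_mod_cast (Real.sqrt_pos.mpr hY).ne'
  have hss : ((√Y : ℝ) : ℂ) ^ 2 = Y := by exact_mod_cast Real.sq_sqrt hY.le
  have hL : ∀ n : ℤ, ((-(2 * (Real.exp (-Real.pi * (Y * (n + V / Y) ^ 2)) * (√Y / Y))) : ℝ) *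
        exp (-(2 * Real.pi * I * n * ζ)) : ℂ) = -(2 * ((√Y : ℝ) / Y)) * exp (-Real.pi * V ^ 2 / Y) *
        exp (-Real.pi * Y * n ^ 2 + 2 * Real.pi * -(V + I * ζ) * n) := fun n => by
    push_cast
    rw [mul_assoc _ (exp (-Real.pi * V ^ 2 / Y)), ← exp_add, mul_comm (exp _), ← mul_assoc,
      ← neg_mul, mul_assoc _ (exp _), ← exp_add]
    congr 2
    field_simp
    ring
  have hR : ∀ b : ℤ, exp (-Real.pi / Y * (b + I * -(V + I * ζ)) ^ 2) =
      exp (Real.pi * V ^ 2 / Y) *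
        exp (-(Real.pi / Y) * ((ζ + b) ^ 2 - 2 * I * V * (ζ + b))) := fun b => by
    rw [← exp_add]
    congr 1
    have : I ^ 2 = -1 := I_sq
    field_simp
    linear_combination (2 * ζ * b - 2 * ζ * V * I + ζ ^ 2 - ζ ^ 2 * I ^ 2 - V ^ 2) * this
  rw [tsum_congr hL, tsum_mul_left, hP, tsum_congr hR, tsum_mul_left, hsq]
  have he : exp (-Real.pi * V ^ 2 / Y) * exp (Real.pi * V ^ 2 / Y) = 1 := by
    rw [← exp_add, ← exp_zero]
    congr 1
    ring
  generalize ∑' b : ℤ, exp (-(Real.pi / Y) * ((ζ + b) ^ 2 - 2 * I * V * (ζ + b))) = S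
  generalize exp (-Real.pi * V ^ 2 / Y) = u at he ⊢
  generalize exp (Real.pi * V ^ 2 / Y) = v at he ⊢
  field_simp
  linear_combination -S * he

/-- Changing `V` by the period `Y` multiplies the Gaussian cotangent series by `e^{2πiζ}`. -/
theorem rowTerm_add_period {Y : ℝ} (hY : 0 < Y) (V : ℝ) (ζ : ℂ) (b : ℤ) :
    rowTerm Y (V + Y) ζ b = exp (2 * Real.pi * I * ζ) * rowTerm Y V ζ b := by
  have hYc : (Y : ℂ) ≠ 0 := by exact_mod_cast hY.ne'
  rw [rowTerm, rowTerm, ← mul_div_assoc, ← exp_add]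
  congr 1
  rw [exp_eq_exp_iff_exists_int]
  refine ⟨b, ?_⟩
  push_cast
  field_simp
  ring

theorem signDefect_add_one (n : ℤ) (x : ℝ) :
    signDefect (n + 1) x = signDefect n x + if n = -1 then 2 else 0 := by
  simp only [signDefect, sign_intCast_add_half]
  split_ifs <;> first | omega | ring

/-- Moving V by Y shifts n by one inside the error function; the sign differs only where n crosses
from −1 to 0, whence the −2. With x = e^{2πiζ}, this is exactly what makes 1/(1−x) − 1 plus half the
sum acquire the factor x. -/
theorem tsum_defectTerm_add_period {Y : ℝ} (hY : 0 < Y) (V : ℝ) (ζ : ℂ) :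
    ∑' n, defectTerm Y (V + Y) ζ n =
      exp (2 * Real.pi * I * ζ) * (∑' n, defectTerm Y V ζ n - 2) := by
  have hterm : ∀ n : ℤ, defectTerm Y (V + Y) ζ n = exp (2 * Real.pi * I * ζ) *
      (defectTerm Y V ζ (n + 1) - if n + 1 = 0 then 2 else 0) := fun n => by
    have h1 : ((n + (V + Y) / Y) * √Y : ℝ) = (((n + 1 : ℤ) : ℝ) + V / Y) * √Y := by
      push_cast
      field_simp
      ring
    rw [defectTerm, defectTerm, h1, signDefect_add_one]
    have h2 : exp (-(2 * Real.pi * I * n * ζ)) = exp (2 * Real.pi * I * ζ) *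
        exp (-(2 * Real.pi * I * ((n + 1 : ℤ) : ℂ) * ζ)) := by
      rw [← exp_add]
      congr 1
      push_cast
      ring
    rw [h2]
    by_cases hn : n = -1
    · subst hn
      simp
      ring
    · rw [if_neg hn, if_neg (by omega)]
      push_cast
      ring
  rw [tsum_congr hterm, tsum_mul_left]
  congr 1
  refine ((Equiv.addRight (1 : ℤ)).tsum_eq
    fun n => defectTerm Y V ζ n - if n = 0 then (2 : ℂ) else 0).trans ?_
  rw [(summable_defectTerm hY V ζ).tsum_sub (hasSum_ite_eq (0 : ℤ) (2 : ℂ)).summable, tsum_ite_eq]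

/-- A geometric series completed by error functions equals a Gaussian-regularized cotangent
series. -/
theorem row_identity {Y : ℝ} (hY : 0 < Y) (V : ℝ) {ζ : ℂ} {δ : ℝ} (hδ : 0 < δ)
    (hζ : ∀ b : ℤ, δ ≤ ‖ζ + b‖) :
    1 / (1 - exp (2 * Real.pi * I * ζ)) - 1 + 1 / 2 * ∑' n, defectTerm Y V ζ n =
      -(1 / (2 * Real.pi * I)) * ∑' b, rowTerm Y V ζ b := by
  have hYc : (Y : ℂ) ≠ 0 := by exact_mod_cast hY.ne'
  have hπ : (Real.pi : ℂ) ≠ 0 := by exact_mod_cast Real.pi_ne_zero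
  have hne : ∀ b : ℤ, ζ + b ≠ 0 := fun b => norm_pos_iff.mp (hδ.trans_le (hζ b))
  set D : ℝ → ℂ := fun V => 1 / (1 - exp (2 * Real.pi * I * ζ)) - 1 +
    1 / 2 * ∑' n, defectTerm Y V ζ n + 1 / (2 * Real.pi * I) * ∑' b, rowTerm Y V ζ b with hD
  -- Both series may be differentiated termwise, locally uniformly in V, and the derivatives cancel
  -- by `tsum_gaussian_eq`.
  have hderiv : ∀ V, HasDerivAt D 0 V := fun V => by
    have hV : V ∈ Metric.ball (0 : ℝ) (|V| + 1) := by simp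
    have h1 := hasDerivAt_tsum_of_isPreconnected
      (summable_gaussian_mul_exp (T := 3 / 4 * Y) (by positivity) _ _)
      Metric.isOpen_ball (convex_ball (0 : ℝ) (|V| + 1)).isPreconnected
      (fun n V _ => hasDerivAt_defectTerm hY V ζ n)
      (fun n V' hV' => norm_deriv_defectTerm_le hY (by simpa using hV') ζ n) hV
      (summable_defectTerm hY V ζ) hV
    have h2 := hasDerivAt_tsum_of_isPreconnected
      ((summable_gaussian_mul_exp (T := 1 / (2 * Y)) (by positivity) 0 _).mul_left
        ‖(2 * Real.pi * I / Y : ℂ)‖)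
      Metric.isOpen_ball (convex_ball (0 : ℝ) (|V| + 1)).isPreconnected
      (fun b V _ => hasDerivAt_rowTerm Y V (hne b))
      (fun b V' hV' => (norm_mul_le _ _).trans
        (mul_le_mul_of_nonneg_left (norm_exp_row_le hY (by simpa using hV') ζ b)
          (norm_nonneg _))) hV (summable_rowTerm hY V hδ hζ) hV
    refine (((h1.const_mul (1 / 2)).const_add _).add
      (h2.const_mul (1 / (2 * Real.pi * I)))).congr_deriv ?_
    rw [tsum_gaussian_eq hY, tsum_mul_left]
    field_simp
    ring
  have h1 : exp (2 * Real.pi * I * ζ) ≠ 1 := fun h => by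
    obtain ⟨n, hn⟩ := exp_eq_one_iff.mp h
    refine hne (-n) ?_
    have : (2 * Real.pi * I : ℂ) * (ζ + (-n : ℤ)) = 0 := by
      push_cast
      linear_combination hn
    exact (mul_eq_zero.mp this).resolve_left two_pi_I_ne_zero
  -- A constant function with multiplier e^{2πiζ} ≠ 1 must vanish.
  have hper : D (V + Y) = exp (2 * Real.pi * I * ζ) * D V := by
    have h2 := sub_ne_zero.mpr h1.symm
    simp only [hD]
    rw [tsum_defectTerm_add_period hY, tsum_congr (rowTerm_add_period hY V ζ), tsum_mul_left]
    field_simp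
    ring
  have hconst : D (V + Y) = D V :=
    is_const_of_deriv_eq_zero (fun V => (hderiv V).differentiableAt) (fun V => (hderiv V).deriv) _ _
  have hz : D V = 0 := by
    have : (exp (2 * Real.pi * I * ζ) - 1) * D V = 0 := by
      rw [sub_mul, ← hper, hconst]
      ring
    exact (mul_eq_zero.mp this).resolve_left (sub_ne_zero.mpr h1)
  simp only [hD] at hz
  linear_combination hz

/-! ### Gaussian Kronecker series over a lattice -/

/-- The point of the lattice `ℤω₁ + ℤω₂` with coordinates `p`. -/
noncomputable def latPt (ω₁ ω₂ : ℂ) (p : ℤ × ℤ) : ℂ := p.1 * ω₁ + p.2 * ω₂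

/-- The summand at the lattice point `w` of the Gaussian Kronecker series. -/
noncomputable def kernelAt (κ : ℝ) (w z₁ z₂ : ℂ) : ℂ :=
  exp (κ * (w * conj z₂ - conj w * z₂ - (z₁ + w) * conj (z₁ + w))) / (z₁ + w)

/-- The Gaussian Kronecker series of the lattice `ℤω₁ + ℤω₂`. -/
noncomputable def kernelSum (κ : ℝ) (ω₁ ω₂ z₁ z₂ : ℂ) : ℂ :=
  ∑' p : ℤ × ℤ, kernelAt κ (latPt ω₁ ω₂ p) z₁ z₂

/-! ### Convergence and real differentiability of the series -/

theorem exists_le_normSq_latPt {τ : ℂ} (hτ : 0 < τ.im) :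
    ∃ r > 0, ∀ p : ℤ × ℤ, r * ((p.1 : ℝ) ^ 2 + (p.2 : ℝ) ^ 2) ≤ ‖latPt τ 1 p‖ ^ 2 := by
  set z : UpperHalfPlane := ⟨τ, hτ⟩
  have hr := EisensteinSeries.r_pos z
  refine ⟨EisensteinSeries.r z ^ 2 / 2, by positivity, fun p => ?_⟩
  by_cases hp : (![p.1, p.2] : Fin 2 → ℤ) = 0
  · have h1 : p.1 = 0 := by simpa using congrFun hp 0
    have h2 : p.2 = 0 := by simpa using congrFun hp 1
    simp [h1, h2]
  · have h := EisensteinSeries.r_mul_max_le z hp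
    have h1 := EisensteinSeries.abs_le_left_of_norm p.2 p.1
    have h2 := EisensteinSeries.abs_le_right_of_norm p.2 p.1
    set N := ‖(![p.1, p.2] : Fin 2 → ℤ)‖
    have h1' : (p.1 : ℝ) ^ 2 ≤ N ^ 2 := by
      rw [← sq_abs]; gcongr; exact_mod_cast h1
    have h2' : (p.2 : ℝ) ^ 2 ≤ N ^ 2 := by
      rw [← sq_abs]; gcongr; exact_mod_cast h2
    have h3 : (EisensteinSeries.r z * N) ^ 2 ≤ ‖latPt τ 1 p‖ ^ 2 := by
      gcongr
      simpa [latPt, z] using h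
    refine le_trans ?_ h3
    rw [mul_pow]
    nlinarith [sq_nonneg (EisensteinSeries.r z)]

/-- Only finitely many lattice points lie within distance 1 of −z, and the least of finitely many
positive distances is positive. -/
theorem exists_le_norm_add_latPt {τ : ℂ} (hτ : 0 < τ.im) {z : ℂ}
    (hz : ∀ p : ℤ × ℤ, z + latPt τ 1 p ≠ 0) :
    ∃ δ > 0, ∀ p : ℤ × ℤ, δ ≤ ‖z + latPt τ 1 p‖ := by
  obtain ⟨r, hr, hrb⟩ := exists_le_normSq_latPt hτ
  have hfin : {p : ℤ × ℤ | ‖z + latPt τ 1 p‖ < 1}.Finite := by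
    set N := ⌈(1 + ‖z‖) ^ 2 / r⌉
    refine (((Finset.Icc (-N) N) ×ˢ (Finset.Icc (-N) N)).finite_toSet).subset fun p hp => ?_
    have h1 : ‖latPt τ 1 p‖ ≤ 1 + ‖z‖ := by
      have := norm_sub_le (z + latPt τ 1 p) z
      rw [add_sub_cancel_left] at this
      have hp' : ‖z + latPt τ 1 p‖ < 1 := hp
      linarith
    have h2 : (p.1 : ℝ) ^ 2 + (p.2 : ℝ) ^ 2 ≤ (1 + ‖z‖) ^ 2 / r := by
      rw [le_div_iff₀ hr, mul_comm]
      exact (hrb p).trans (by gcongr)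
    have h3 : p.1 ^ 2 + p.2 ^ 2 ≤ N := by
      have := h2.trans (Int.le_ceil _)
      exact_mod_cast this
    have habs : ∀ x : ℤ, x ^ 2 ≤ N → -N ≤ x ∧ x ≤ N := fun x hx =>
      ⟨by nlinarith [Int.le_self_sq (-x)], by nlinarith [Int.le_self_sq x]⟩
    simp only [Finset.coe_product, Finset.coe_Icc, Set.mem_prod, Set.mem_Icc]
    exact ⟨habs _ (by nlinarith [sq_nonneg p.2]), habs _ (by nlinarith [sq_nonneg p.1])⟩
  rcases hfin.toFinset.eq_empty_or_nonempty with he | hne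
  · refine ⟨1, one_pos, fun p => ?_⟩
    by_contra! h
    exact (Finset.eq_empty_iff_forall_notMem.mp he) p (by simpa using h)
  · obtain ⟨p₀, -, hp₀⟩ := hfin.toFinset.exists_min_image (fun p => ‖z + latPt τ 1 p‖) hne
    refine ⟨min 1 ‖z + latPt τ 1 p₀‖, lt_min one_pos (norm_pos_iff.mpr (hz p₀)), fun p => ?_⟩
    by_cases h : ‖z + latPt τ 1 p‖ < 1
    · exact (min_le_right _ _).trans (hp₀ p (by simpa using h))
    · exact (min_le_left _ _).trans (not_lt.mp h)

/-- The part w z̄₂ − w̄ z₂ of the exponent is purely imaginary, so z₂ plays no role in convergence.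
-/
theorem norm_kernelAt (κ : ℝ) (w z₁ z₂ : ℂ) :
    ‖kernelAt κ w z₁ z₂‖ = Real.exp (-(κ * ‖z₁ + w‖ ^ 2)) / ‖z₁ + w‖ := by
  rw [kernelAt, norm_div, norm_exp, re_ofReal_mul, mul_conj, normSq_eq_norm_sq]
  congr 2
  rw [← mul_neg]
  congr 1
  simp only [sub_re, mul_re, conj_re, conj_im, ofReal_re]
  ring

/-- The differential of `kernelAt` in `(z₁, z₂)`. -/
noncomputable def kernelAtDeriv (κ : ℝ) (w : ℂ) (q : ℂ × ℂ) : ℂ × ℂ →L[ℝ] ℂ :=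
  kernelAt κ w q.1 q.2 •
    ((κ : ℂ) • (w • (conjCLE.toContinuousLinearMap ∘L .snd ℝ ℂ ℂ) -
        conj w • .snd ℝ ℂ ℂ - ((q.1 + w) • (conjCLE.toContinuousLinearMap ∘L .fst ℝ ℂ ℂ) +
          conj (q.1 + w) • .fst ℝ ℂ ℂ)) -
      (q.1 + w)⁻¹ • .fst ℝ ℂ ℂ)

theorem hasFDerivAt_kernelAt (κ : ℝ) {w : ℂ} {q : ℂ × ℂ} (hq : q.1 + w ≠ 0) :
    HasFDerivAt (fun q : ℂ × ℂ => kernelAt κ w q.1 q.2) (kernelAtDeriv κ w q) q := by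
  have h1 : HasFDerivAt (fun q : ℂ × ℂ => q.1 + w) (.fst ℝ ℂ ℂ) q := hasFDerivAt_fst.add_const w
  have h2 : HasFDerivAt (fun q : ℂ × ℂ => conj (q.1 + w))
      (conjCLE.toContinuousLinearMap ∘L .fst ℝ ℂ ℂ) q :=
    conjCLE.toContinuousLinearMap.hasFDerivAt.comp q h1
  have h3 : HasFDerivAt (fun q : ℂ × ℂ => conj q.2)
      (conjCLE.toContinuousLinearMap ∘L .snd ℝ ℂ ℂ) q :=
    conjCLE.toContinuousLinearMap.hasFDerivAt.comp q hasFDerivAt_snd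
  have h4 := ((((h3.const_mul w).sub ((hasFDerivAt_snd (𝕜 := ℝ) (p := q)).const_mul (conj w))).sub
    (h1.mul h2)).const_mul (κ : ℂ)).cexp
  have h5 : HasFDerivAt (fun q : ℂ × ℂ => (q.1 + w)⁻¹) (-((q.1 + w) ^ 2)⁻¹ • .fst ℝ ℂ ℂ) q :=
    ((hasDerivAt_inv hq).hasFDerivAt.restrictScalars ℝ).comp q h1 |>.congr_fderiv (by
      ext <;> simp [mul_comm])
  refine (h4.mul h5).congr_fderiv ?_
  ext v
  · simp [kernelAtDeriv, kernelAt]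
    field_simp
    ring
  · simp [kernelAtDeriv, kernelAt]
    field_simp

theorem norm_kernelAtDeriv_le {κ : ℝ} (hκ : 0 < κ) (w : ℂ) (q : ℂ × ℂ) :
    ‖kernelAtDeriv κ w q‖ ≤ Real.exp (-(κ * ‖q.1 + w‖ ^ 2)) / ‖q.1 + w‖ *
      (κ * (2 * ‖w‖ + 2 * ‖q.1 + w‖) + ‖q.1 + w‖⁻¹) := by
  refine ContinuousLinearMap.opNorm_le_bound _ (by positivity) fun v => ?_
  have h1 : ‖v.1‖ ≤ ‖v‖ := norm_fst_le v
  have h2 : ‖v.2‖ ≤ ‖v‖ := norm_snd_le v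
  have hv : kernelAtDeriv κ w q v = kernelAt κ w q.1 q.2 * (κ * (w * conj v.2 - conj w * v.2 -
      ((q.1 + w) * conj v.1 + conj (q.1 + w) * v.1)) - (q.1 + w)⁻¹ * v.1) := by
    simp [kernelAtDeriv]
  rw [hv, norm_mul, norm_kernelAt, mul_assoc]
  gcongr
  refine (norm_sub_le _ _).trans ?_
  rw [norm_mul, norm_mul, norm_real, Real.norm_of_nonneg hκ.le, norm_inv,
    add_mul (κ * _), mul_assoc κ]
  gcongr
  refine (norm_sub_le _ _).trans ?_
  refine (add_le_add (norm_sub_le _ _) (norm_add_le _ _)).trans ?_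
  simp only [norm_mul, RCLike.norm_conj]
  nlinarith [norm_nonneg w, norm_nonneg (q.1 + w), mul_le_mul_of_nonneg_left h1 (norm_nonneg (q.1 + w)),
    mul_le_mul_of_nonneg_left h2 (norm_nonneg w)]

/-- A common bound for the summands and their differentials. -/
theorem exists_kernel_bound {τ : ℂ} (hτ : 0 < τ.im) {κ : ℝ} (hκ : 0 < κ) {δ : ℝ} (hδ : 0 < δ)
    (R : ℝ) :
    ∃ u : ℤ × ℤ → ℝ, Summable u ∧ ∀ (p : ℤ × ℤ) (z : ℂ), ‖z‖ ≤ R → δ ≤ ‖z + latPt τ 1 p‖ →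
      Real.exp (-(κ * ‖z + latPt τ 1 p‖ ^ 2)) / ‖z + latPt τ 1 p‖ *
        (κ * (2 * ‖latPt τ 1 p‖ + 2 * ‖z + latPt τ 1 p‖) + ‖z + latPt τ 1 p‖⁻¹ + 1) ≤ u p := by
  obtain ⟨r, hr, hrb⟩ := exists_le_normSq_latPt hτ
  have hπ := Real.pi_pos
  -- With X = |z+w|, half of e^{−κX²} absorbs the polynomial factor. The other half decays in p,
  -- since r(p₁²+p₂²) ≤ |w|² ≤ 2X² + 2R²; this gives the rate πc = κr/4. The summand +1 in the bound
  -- lets one u dominate both the terms and their differentials.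
  set c := κ * r / (4 * Real.pi)
  have hc : 0 < c := by positivity
  set C := (5 + 2 * κ + κ * (2 * |R|) + δ⁻¹) / δ * Real.exp (κ * R ^ 2 / 2)
  have hs := summable_gaussian_mul_exp hc 0 1
  refine ⟨fun p => C * (1 * Real.exp (-Real.pi * (c * p.1 ^ 2)) *
      Real.exp (2 * Real.pi * 0 * |(p.1 : ℝ)|) * (1 * Real.exp (-Real.pi * (c * p.2 ^ 2)) *
      Real.exp (2 * Real.pi * 0 * |(p.2 : ℝ)|))),
    (hs.mul_of_nonneg hs (fun _ => by positivity) (fun _ => by positivity)).mul_left C,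
    fun p z hz hX => ?_⟩
  have hw : ‖latPt τ 1 p‖ ≤ ‖z + latPt τ 1 p‖ + |R| := by
    have := norm_sub_le (z + latPt τ 1 p) z
    rw [add_sub_cancel_left] at this
    linarith [le_abs_self R]
  have hb := hrb p
  set W := ‖latPt τ 1 p‖
  set X := ‖z + latPt τ 1 p‖
  have hW : 0 ≤ W := norm_nonneg _
  have hX0 : 0 < X := hδ.trans_le hX
  simp only [mul_zero, zero_mul, Real.exp_zero, mul_one, one_mul]
  have h1 : κ * (2 * W + 2 * X) + X⁻¹ + 1 ≤
      (5 + 2 * κ + κ * (2 * |R|) + δ⁻¹) * Real.exp (κ * X ^ 2 / 2) := by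
    have e1 := Real.add_one_le_exp (κ * X ^ 2 / 2)
    have e2 : X⁻¹ ≤ δ⁻¹ := by gcongr
    have e3 : κ * (2 * W + 2 * X) ≤ κ * (4 * X + 2 * |R|) := by
      refine mul_le_mul_of_nonneg_left ?_ hκ.le
      linarith
    have e5 : κ * (4 * X) ≤ (2 * κ + 4) * (κ * X ^ 2 / 2 + 1) := by
      have : 0 ≤ κ * (X - 1) ^ 2 := by positivity
      have : 0 ≤ κ * (κ * X ^ 2) := by positivity
      nlinarith
    have e6 : 0 ≤ κ * X ^ 2 / 2 := by positivity
    have e7 : 0 ≤ δ⁻¹ := by positivity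
    have e8 : 0 ≤ κ * (2 * |R|) := by positivity
    calc _ ≤ (2 * κ + 4) * (κ * X ^ 2 / 2 + 1) + κ * (2 * |R|) + δ⁻¹ + 1 := by linarith
      _ ≤ (5 + 2 * κ + κ * (2 * |R|) + δ⁻¹) * (κ * X ^ 2 / 2 + 1) := by nlinarith
      _ ≤ _ := by gcongr
  have hW2 : W ^ 2 ≤ 2 * X ^ 2 + 2 * R ^ 2 := by
    rw [← sq_abs R]
    nlinarith [sq_nonneg (X - |R|), abs_nonneg R]
  calc Real.exp (-(κ * X ^ 2)) / X * (κ * (2 * W + 2 * X) + X⁻¹ + 1)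
      ≤ Real.exp (-(κ * X ^ 2)) / δ *
        ((5 + 2 * κ + κ * (2 * |R|) + δ⁻¹) * Real.exp (κ * X ^ 2 / 2)) := by gcongr
    _ = (5 + 2 * κ + κ * (2 * |R|) + δ⁻¹) / δ * Real.exp (-(κ * X ^ 2 / 2)) := by
        rw [show -(κ * X ^ 2) = -(κ * X ^ 2 / 2) + -(κ * X ^ 2 / 2) by ring, Real.exp_add,
          Real.exp_neg]
        field_simp
    _ ≤ (5 + 2 * κ + κ * (2 * |R|) + δ⁻¹) / δ * (Real.exp (κ * R ^ 2 / 2) *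
          (Real.exp (-Real.pi * (c * p.1 ^ 2)) * Real.exp (-Real.pi * (c * p.2 ^ 2)))) := by
        rw [← Real.exp_add, ← Real.exp_add]
        gcongr
        have hcc : Real.pi * c = κ * r / 4 := by
          simp only [c]
          field_simp
        have : κ * (r * ((p.1 : ℝ) ^ 2 + (p.2 : ℝ) ^ 2)) ≤ κ * (2 * X ^ 2 + 2 * R ^ 2) := by
          gcongr
          exact hb.trans hW2
        nlinarith
    _ = _ := by simp only [C]; ring

theorem summable_kernelAt {τ : ℂ} (hτ : 0 < τ.im) {κ : ℝ} (hκ : 0 < κ) {z₁ : ℂ}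
    (hz : ∀ p : ℤ × ℤ, z₁ + latPt τ 1 p ≠ 0) (z₂ : ℂ) :
    Summable fun p => kernelAt κ (latPt τ 1 p) z₁ z₂ := by
  obtain ⟨δ, hδ, hb⟩ := exists_le_norm_add_latPt hτ hz
  obtain ⟨u, hu, hub⟩ := exists_kernel_bound hτ hκ hδ ‖z₁‖
  refine .of_norm_bounded hu fun p => le_trans ?_ (hub p z₁ le_rfl (hb p))
  rw [norm_kernelAt]
  refine le_mul_of_one_le_right (by positivity) ?_
  have : 0 ≤ κ * (2 * ‖latPt τ 1 p‖ + 2 * ‖z₁ + latPt τ 1 p‖) + ‖z₁ + latPt τ 1 p‖⁻¹ := by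
    positivity
  linarith

theorem eventually_add_latPt_ne_zero {τ : ℂ} (hτ : 0 < τ.im) {z : ℂ}
    (hz : ∀ p : ℤ × ℤ, z + latPt τ 1 p ≠ 0) :
    ∀ᶠ z' in nhds z, ∀ p : ℤ × ℤ, z' + latPt τ 1 p ≠ 0 := by
  obtain ⟨δ, hδ, hb⟩ := exists_le_norm_add_latPt hτ hz
  filter_upwards [Metric.ball_mem_nhds z hδ] with z' hz' p h
  have h1 := hb p
  rw [Metric.mem_ball, dist_eq] at hz'
  have : z + latPt τ 1 p = -(z' - z) := by linear_combination h
  rw [this, norm_neg] at h1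
  linarith

theorem differentiableAt_kernelSum {τ : ℂ} (hτ : 0 < τ.im) {κ : ℝ} (hκ : 0 < κ) {z₁ : ℂ}
    (hz : ∀ p : ℤ × ℤ, z₁ + latPt τ 1 p ≠ 0) (z₂ : ℂ) :
    DifferentiableAt ℝ (fun q : ℂ × ℂ => kernelSum κ τ 1 q.1 q.2) (z₁, z₂) := by
  obtain ⟨δ, hδ, hb⟩ := exists_le_norm_add_latPt hτ hz
  obtain ⟨u, hu, hub⟩ := exists_kernel_bound hτ hκ (half_pos hδ) (‖z₁‖ + δ)
  set s : Set (ℂ × ℂ) := Metric.ball (z₁, z₂) (δ / 2)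
  have hs : (z₁, z₂) ∈ s := Metric.mem_ball_self (half_pos hδ)
  have hdist : ∀ q ∈ s, ‖q.1 - z₁‖ < δ / 2 := fun q hq => by
    have hq' : dist q (z₁, z₂) < δ / 2 := hq
    rw [Prod.dist_eq, max_lt_iff, dist_eq] at hq'
    exact hq'.1
  have hlow : ∀ (p : ℤ × ℤ), ∀ q ∈ s, δ / 2 ≤ ‖q.1 + latPt τ 1 p‖ := fun p q hq => by
    have h1 := norm_sub_le (q.1 + latPt τ 1 p) (q.1 - z₁)
    rw [show q.1 + latPt τ 1 p - (q.1 - z₁) = z₁ + latPt τ 1 p by ring] at h1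
    linarith [hb p, hdist q hq]
  refine (hasFDerivAt_tsum_of_isPreconnected hu Metric.isOpen_ball
    (convex_ball (z₁, z₂) (δ / 2)).isPreconnected
    (fun p q hq => hasFDerivAt_kernelAt κ (norm_pos_iff.mp ((half_pos hδ).trans_le (hlow p q hq))))
    (fun p q hq => ?_) hs (summable_kernelAt hτ hκ hz z₂) hs).differentiableAt
  have hq1 : ‖q.1‖ ≤ ‖z₁‖ + δ := by
    have := norm_add_le (q.1 - z₁) z₁
    rw [sub_add_cancel] at this
    linarith [hdist q hq]
  refine (norm_kernelAtDeriv_le hκ _ q).trans (le_trans ?_ (hub p q.1 hq1 (hlow p q hq)))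
  exact mul_le_mul_of_nonneg_left (by linarith) (by positivity)

/-! ### Summation over residue classes -/

theorem sum_range_tsum_int {M : ℕ} (hM : 0 < M) {f : ℤ → ℂ} (hf : Summable f) :
    ∑ p ∈ Finset.range M, ∑' c : ℤ, f (p + M * c) = ∑' n, f n := by
  have : NeZero M := ⟨hM.ne'⟩
  set e : Fin M × ℤ ≃ ℤ := (Equiv.prodComm _ _).trans (Int.divModEquiv M).symm
  have he : ∀ q : Fin M × ℤ, e q = (q.1 : ℕ) + M * q.2 := fun q => by
    simp [e, Int.divModEquiv]
    ring
  have hs : Summable fun q => f (e q) := e.summable_iff.mpr hf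
  rw [← e.tsum_eq f, hs.tsum_prod, tsum_fintype, Finset.sum_range]
  exact Finset.sum_congr rfl fun p _ => tsum_congr fun c => by rw [he]

/-- The sign σ lets residues be enumerated upwards or downwards; both are needed because the second
index of Ψ̃ in the characters carries a minus sign. -/
theorem sum_range_tsum_int_of_isUnit {M : ℕ} (hM : 0 < M) {σ : ℤ} (hσ : σ * σ = 1) {f : ℤ → ℂ}
    (hf : Summable f) :
    ∑ p ∈ Finset.range M, ∑' c : ℤ, f (σ * p + c * M) = ∑' n, f n := by
  set e : ℤ ≃ ℤ := ⟨fun n => σ * n, fun n => σ * n, fun n => by simp [← mul_assoc, hσ],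
    fun n => by simp [← mul_assoc, hσ]⟩
  have hs : Summable fun n => f (e n) := e.summable_iff.mpr hf
  rw [← e.tsum_eq f, ← sum_range_tsum_int hM hs]
  refine Finset.sum_congr rfl fun p _ => ?_
  rw [← e.tsum_eq]
  refine tsum_congr fun c => congrArg f ?_
  change σ * p + σ * c * M = σ * (p + M * c)
  ring

/-- Orthogonality of characters modulo M. Coprimality guarantees that the root of unity is trivial
only when M divides d. -/
theorem sum_range_exp_eq {M : ℕ} (hM : 0 < M) {m : ℕ} (hgcd : Nat.gcd M m = 1) {σ : ℤ}
    (hσ : σ * σ = 1) (d : ℤ) :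
    ∑ s ∈ Finset.range M, exp (-(2 * Real.pi * I * (m / M) * (σ * s * d))) =
      if (M : ℤ) ∣ d then (M : ℂ) else 0 := by
  have hMc : (M : ℂ) ≠ 0 := by exact_mod_cast hM.ne'
  set x := exp (-(2 * Real.pi * I * (m / M) * (σ * d))) with hx
  have hpow : ∀ s : ℕ, exp (-(2 * Real.pi * I * (m / M) * (σ * s * d))) = x ^ s := fun s => by
    rw [hx, ← exp_nat_mul]
    congr 1
    ring
  have hxM : x ^ M = 1 := by
    rw [hx, ← exp_nat_mul, exp_eq_one_iff]
    refine ⟨-(m * (σ * d)), ?_⟩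
    push_cast
    field_simp
  simp only [hpow]
  split_ifs with hd
  · obtain ⟨k, rfl⟩ := hd
    have : x = 1 := by
      rw [hx, exp_eq_one_iff]
      refine ⟨-(m * (σ * k)), ?_⟩
      push_cast
      field_simp
    simp [this]
  · have hx1 : x ≠ 1 := fun h => by
      rw [hx, exp_eq_one_iff] at h
      obtain ⟨n, hn⟩ := h
      have h1 : -((m : ℂ) * (σ * d)) = n * M := by
        have h2 := two_pi_I_ne_zero
        field_simp at hn
        linear_combination hn
      have h2 : -((m : ℤ) * (σ * d)) = n * M := by exact_mod_cast h1
      have h3 : (M : ℤ) ∣ m * (σ * d) := ⟨-n, by linear_combination -h2⟩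
      have h4 : IsCoprime (M : ℤ) m := Nat.isCoprime_iff_coprime.mpr hgcd
      have h5 := (h4.dvd_of_dvd_mul_left h3).mul_left σ
      rw [← mul_assoc, hσ, one_mul] at h5
      exact hd h5
    rw [geom_sum_eq hx1, hxM]
    simp

/-! ### Transformation laws of the Gaussian Kronecker series -/

theorem kernelAt_smul (κ : ℝ) {l : ℂ} (hl : l ≠ 0) (w z₁ z₂ : ℂ) :
    kernelAt (κ / normSq l) (l * w) (l * z₁) (l * z₂) = l⁻¹ * kernelAt κ w z₁ z₂ := by
  have hl' : conj l ≠ 0 := (map_ne_zero _).mpr hl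
  have he : ((κ / normSq l : ℝ) : ℂ) * (l * w * conj (l * z₂) - conj (l * w) * (l * z₂) -
      (l * z₁ + l * w) * conj (l * z₁ + l * w)) =
      κ * (w * conj z₂ - conj w * z₂ - (z₁ + w) * conj (z₁ + w)) := by
    rw [ofReal_div, ← mul_conj]
    simp only [map_mul, map_add]
    field_simp
  rw [kernelAt, kernelAt, he, ← mul_add, ← div_div, div_right_comm, div_eq_inv_mul _ l]

/-- Homogeneity of weight −1. Together with the change of basis in `kernelSum_rotate` it is the
whole inversion τ ↦ −1/τ at the level of lattices. -/
theorem kernelSum_smul (κ : ℝ) {l : ℂ} (hl : l ≠ 0) (ω₁ ω₂ z₁ z₂ : ℂ) :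
    kernelSum (κ / normSq l) (l * ω₁) (l * ω₂) (l * z₁) (l * z₂) =
      l⁻¹ * kernelSum κ ω₁ ω₂ z₁ z₂ := by
  rw [kernelSum, kernelSum, ← tsum_mul_left]
  refine tsum_congr fun p => ?_
  rw [← kernelAt_smul κ hl, latPt, latPt]
  congr 1
  ring

theorem kernelSum_rotate (κ : ℝ) (ω₁ ω₂ z₁ z₂ : ℂ) :
    kernelSum κ (-ω₂) ω₁ z₁ z₂ = kernelSum κ ω₁ ω₂ z₁ z₂ := by
  set e : ℤ × ℤ ≃ ℤ × ℤ := ⟨fun p => (-p.2, p.1), fun p => (p.2, -p.1), fun p => by simp,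
    fun p => by simp⟩
  rw [kernelSum, kernelSum, ← e.tsum_eq]
  refine tsum_congr fun p => ?_
  congr 1
  simp only [latPt, e, Equiv.coe_fn_mk, Int.cast_neg]
  ring

/-- Translating z₁ only reindexes the sum. Translating z₂ by a lattice point changes each exponent
by κ times the symplectic form of two lattice points, an element of 2πiℤ by the normalization of κ.
-/
theorem kernelSum_add_latPt {κ : ℝ} {ω₁ ω₂ : ℂ} {m : ℕ}
    (hκ : κ * (ω₁ * conj ω₂).im = Real.pi * m) (z₁ z₂ : ℂ) (p₀ p₁ : ℤ × ℤ) :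
    kernelSum κ ω₁ ω₂ (z₁ + latPt ω₁ ω₂ p₀) (z₂ + latPt ω₁ ω₂ p₁) =
      exp (-(κ * (latPt ω₁ ω₂ p₀ * conj z₂ - conj (latPt ω₁ ω₂ p₀) * z₂))) *
        kernelSum κ ω₁ ω₂ z₁ z₂ := by
  have hκ' : (κ : ℂ) * (ω₁ * conj ω₂ - conj ω₁ * ω₂) = 2 * Real.pi * I * m := by
    have h1 : ω₁ * conj ω₂ - conj ω₁ * ω₂ = ((2 * (ω₁ * conj ω₂).im : ℝ) : ℂ) * I := by
      rw [← sub_conj, map_mul, conj_conj]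
    have h2 : (κ : ℂ) * ((ω₁ * conj ω₂).im : ℝ) = Real.pi * m := by exact_mod_cast hκ
    rw [h1]
    push_cast
    linear_combination 2 * I * h2
  rw [kernelSum, kernelSum, ← tsum_mul_left, ← (Equiv.addRight p₀).tsum_eq fun p => _ * _]
  refine tsum_congr fun p => ?_
  have hp : latPt ω₁ ω₂ (p + p₀) = latPt ω₁ ω₂ p + latPt ω₁ ω₂ p₀ := by
    simp only [latPt, Prod.fst_add, Prod.snd_add, Int.cast_add]
    ring
  rw [Equiv.coe_addRight, hp, kernelAt, kernelAt, ← mul_div_assoc, ← exp_add,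
    show z₁ + latPt ω₁ ω₂ p₀ + latPt ω₁ ω₂ p = z₁ + (latPt ω₁ ω₂ p + latPt ω₁ ω₂ p₀) by ring]
  congr 1
  rw [exp_eq_exp_iff_exists_int]
  refine ⟨m * (p.1 * p₁.2 - p.2 * p₁.1), ?_⟩
  simp only [latPt, map_add, map_mul, map_intCast]
  push_cast
  linear_combination ((p.1 : ℂ) * p₁.2 - p.2 * p₁.1) * hκ'

theorem kernelAt_isogeny {κ : ℝ} {M m : ℕ} (hM : 0 < M) {τ : ℂ}
    (hκ : κ * (M * τ.im) = Real.pi * m) (u₁ u₂ : ℂ) (a s d c : ℤ) :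
    exp (κ * (a * (τ * conj u₂ - conj τ * u₂))) *
        kernelAt κ (latPt (M * τ) 1 (c, d)) (u₁ + a * τ) (u₂ + s * τ) =
      exp (-(2 * Real.pi * I * (m / M) * (s * d))) * kernelAt κ (latPt τ 1 (a + c * M, d)) u₁ u₂ := by
  have hMc : (M : ℂ) ≠ 0 := by exact_mod_cast hM.ne'
  have hκ' : (κ : ℂ) * (τ - conj τ) = 2 * Real.pi * I * (m / M) := by
    have h2 : (κ : ℂ) * (M * (τ.im : ℝ)) = Real.pi * m := by exact_mod_cast hκ
    rw [sub_conj]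
    push_cast
    field_simp
    linear_combination h2
  rw [kernelAt, kernelAt, ← mul_div_assoc, ← mul_div_assoc, ← exp_add, ← exp_add]
  simp only [latPt, map_add, map_mul, map_intCast, map_natCast, map_one]
  push_cast
  congr 1
  · congr 1
    linear_combination -((s : ℂ) * d) * hκ'
  · ring

/-- The translates by pτ glue the cosets of ℤMτ+ℤ into ℤτ+ℤ. The translates of the second variable
multiply the term at (A, d) by characters of d modulo M, whose sum keeps only M ∣ d, that is, the
lattice ℤτ+ℤM. -/
theorem kernelSum_isogeny {κ : ℝ} (hκ0 : 0 < κ) {M m : ℕ} (hM : 0 < M)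
    (hgcd : Nat.gcd M m = 1) {τ : ℂ} (hτ : 0 < τ.im) (hκ : κ * (M * τ.im) = Real.pi * m)
    {σ σ' : ℤ} (hσ : σ * σ = 1) (hσ' : σ' * σ' = 1) {u₁ : ℂ}
    (hu : ∀ p : ℤ × ℤ, u₁ + latPt τ 1 p ≠ 0) (u₂ : ℂ) :
    ∑ p ∈ Finset.range M, ∑ s ∈ Finset.range M,
        exp (κ * ((σ * p : ℤ) * (τ * conj u₂ - conj τ * u₂))) *
          kernelSum κ (M * τ) 1 (u₁ + (σ * p : ℤ) * τ) (u₂ + (σ' * s : ℤ) * τ) =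
      M * kernelSum κ τ M u₁ u₂ := by
  have hMz : (M : ℤ) ≠ 0 := by exact_mod_cast hM.ne'
  set G : ℤ × ℤ → ℂ := fun p => kernelAt κ (latPt τ 1 p) u₁ u₂ with hG
  have hGs : Summable G := summable_kernelAt hτ hκ0 hu u₂
  set χ : ℤ → ℂ := fun d => if (M : ℤ) ∣ d then (M : ℂ) else 0 with hχ
  have hχG : Summable fun p : ℤ × ℤ => χ p.2 * G p := by
    refine .of_norm_bounded (hGs.norm.mul_left (M : ℝ)) fun p => ?_
    rw [norm_mul]
    gcongr
    simp only [hχ]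
    split_ifs <;> simp
  have hinj : ∀ a : ℤ, Function.Injective fun q : ℤ × ℤ => ((a + q.1 * M, q.2) : ℤ × ℤ) :=
    fun a q q' h => by
      simp only [Prod.mk.injEq, add_right_inj] at h
      exact Prod.ext (mul_right_cancel₀ hMz h.1) h.2
  have hinner : ∀ p : ℕ, ∑ s ∈ Finset.range M,
      exp (κ * ((σ * p : ℤ) * (τ * conj u₂ - conj τ * u₂))) *
          kernelSum κ (M * τ) 1 (u₁ + (σ * p : ℤ) * τ) (u₂ + (σ' * s : ℤ) * τ) =
      ∑' c : ℤ, ∑' d : ℤ, χ d * G (σ * p + c * M, d) := fun p => by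
    have h1 : ∀ s : ℕ, exp (κ * ((σ * p : ℤ) * (τ * conj u₂ - conj τ * u₂))) *
          kernelSum κ (M * τ) 1 (u₁ + (σ * p : ℤ) * τ) (u₂ + (σ' * s : ℤ) * τ) =
        ∑' q : ℤ × ℤ, exp (-(2 * Real.pi * I * (m / M) * (σ' * s * q.2))) *
          G (σ * p + q.1 * M, q.2) := fun s => by
      rw [kernelSum, ← tsum_mul_left]
      refine tsum_congr fun q => (kernelAt_isogeny hM hκ u₁ u₂ _ _ q.2 q.1).trans ?_
      push_cast
      rfl
    have hs1 := hGs.comp_injective (hinj (σ * p))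
    have hs2 : ∀ s ∈ Finset.range M, Summable fun q : ℤ × ℤ =>
        exp (-(2 * Real.pi * I * (m / M) * (σ' * s * q.2))) * G (σ * p + q.1 * M, q.2) := by
      intro s _
      refine .of_norm_bounded hs1.norm fun q => ?_
      rw [norm_mul, show -(2 * Real.pi * I * (m / M) * (σ' * s * q.2) : ℂ) =
        ((-(2 * Real.pi * (m / M) * (σ' * s * q.2)) : ℝ) : ℂ) * I by push_cast; ring,
        norm_exp_ofReal_mul_I, one_mul]
      rfl
    rw [Finset.sum_congr rfl fun s _ => h1 s, ← Summable.tsum_finsetSum hs2]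
    have hs3 := hχG.comp_injective (hinj (σ * p))
    refine (tsum_congr fun q => ?_).trans hs3.tsum_prod
    rw [← Finset.sum_mul, sum_range_exp_eq hM hgcd hσ']
    rfl
  rw [Finset.sum_congr rfl fun p _ => hinner p,
    sum_range_tsum_int_of_isUnit hM hσ (f := fun A => ∑' d : ℤ, χ d * G (A, d)) hχG.prod,
    kernelSum]
  have hinj2 : Function.Injective fun d : ℤ => (M : ℤ) * d := mul_right_injective₀ hMz
  have hs4 : Summable fun q : ℤ × ℤ => G (q.1, M * q.2) :=
    hGs.comp_injective (i := fun q : ℤ × ℤ => ((q.1, M * q.2) : ℤ × ℤ)) fun q q' h => by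
      simp only [Prod.mk.injEq] at h
      exact Prod.ext h.1 (hinj2 h.2)
  have hfin : ∀ q : ℤ × ℤ, kernelAt κ (latPt τ M q) u₁ u₂ = G (q.1, M * q.2) := fun q => by
    simp only [hG, latPt]
    push_cast
    congr 1
    ring
  rw [tsum_congr hfin, hs4.tsum_prod, ← tsum_mul_left]
  refine tsum_congr fun A => ?_
  rw [← tsum_mul_left, ← hinj2.tsum_eq]
  · exact tsum_congr fun d => by simp [hχ]
  · intro d hd
    by_contra h
    refine hd ?_
    have : ¬(M : ℤ) ∣ d := fun ⟨k, hk⟩ => h ⟨k, hk.symm⟩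
    simp [hχ, this]

/-! ### The modified mock theta function as a Gaussian Kronecker series -/

/-- The multiplier of the diagonal translation by `aτ` in index `N`. -/
noncomputable def diagMult (N : ℕ) (τ z₁ z₂ : ℂ) (a : ℤ) : ℂ :=
  exp (2 * Real.pi * I * N * ((a : ℂ) ^ 2 * τ + a * (z₁ + z₂)))

/-- The factor relating `Φ̃` to the Gaussian Kronecker series. -/
noncomputable def gauge (N : ℕ) (τ z₁ z₂ : ℂ) : ℂ :=
  exp (-(2 * Real.pi * I * N * z₁ * ((z₂ - conj z₂) / (τ - conj τ))))

theorem sub_conj_ne_zero {τ : ℂ} (hτ : 0 < τ.im) : τ - conj τ ≠ 0 := by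
  rw [sub_conj]
  simp [hτ.ne']

theorem ofReal_im_eq (z : ℂ) : (z.im : ℂ) = (z - conj z) / (2 * I) := by
  rw [sub_conj]
  field_simp
  push_cast
  ring

theorem diagMult_mul_rowTerm {N : ℕ} {τ : ℂ} (hτ : 0 < τ.im) (z₁ z₂ : ℂ) (p : ℤ × ℤ) :
    diagMult N τ z₁ z₂ p.1 * rowTerm (τ.im / N) (z₁ - z₂).im (z₁ + p.1 * τ) p.2 =
      gauge N τ z₁ z₂ * kernelAt (Real.pi * N / τ.im) (latPt τ 1 p) z₁ z₂ := by
  have h := sub_conj_ne_zero hτ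
  rw [diagMult, rowTerm, gauge, kernelAt, ← mul_div_assoc, ← mul_div_assoc, ← exp_add, ← exp_add,
    show z₁ + latPt τ 1 p = z₁ + p.1 * τ + p.2 by simp only [latPt]; ring]
  congr 1
  rw [exp_eq_exp_iff_exists_int]
  -- The exponents agree only up to the integer multiple N·a·b of 2πi at the lattice point aτ + b.
  refine ⟨-(N * (p.1 * p.2)), ?_⟩
  push_cast
  simp only [ofReal_im_eq, latPt, map_add, map_sub, map_mul, map_intCast, map_one]
  generalize conj τ = τ' at h ⊢
  generalize conj z₁ = z₁'
  generalize conj z₂ = z₂'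
  field_simp
  ring

/-- Absolute convergence over the lattice allows summation row by row, and each row is evaluated by
`row_identity` with Y = Im τ/N and V = Im(z₁ − z₂). -/
theorem hasSum_diagMult_mul_row {N : ℕ} (hN : 0 < N) {τ : ℂ} (hτ : 0 < τ.im) {z₁ : ℂ}
    (hz : ∀ p : ℤ × ℤ, z₁ + latPt τ 1 p ≠ 0) (z₂ : ℂ) :
    HasSum (fun a : ℤ => diagMult N τ z₁ z₂ a *
      (1 / (1 - exp (2 * Real.pi * I * (z₁ + a * τ))) - 1 +
        1 / 2 * ∑' n, defectTerm (τ.im / N) (z₁ - z₂).im (z₁ + a * τ) n))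
      (-(1 / (2 * Real.pi * I)) *
        (gauge N τ z₁ z₂ * kernelSum (Real.pi * N / τ.im) τ 1 z₁ z₂)) := by
  have hY : 0 < τ.im / N := by positivity
  obtain ⟨δ, hδ, hb⟩ := exists_le_norm_add_latPt hτ hz
  have hb' : ∀ a b : ℤ, δ ≤ ‖z₁ + a * τ + b‖ := fun a b => by
    simpa [latPt, add_assoc] using hb (a, b)
  have h1 := (((summable_kernelAt hτ (κ := Real.pi * N / τ.im) (by have := Real.pi_pos; positivity)
    hz z₂).hasSum.mul_left (gauge N τ z₁ z₂)).mul_left (-(1 / (2 * Real.pi * I) : ℂ)))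
  refine h1.prod_fiberwise fun a => ?_
  rw [row_identity hY _ hδ (hb' a), mul_left_comm]
  refine HasSum.mul_left _ ?_
  refine ((summable_rowTerm hY (z₁ - z₂).im hδ (hb' a)).hasSum.mul_left _).congr_fun ?_
  exact fun b => (diagMult_mul_rowTerm hτ z₁ z₂ (a, b)).symm

/-! ### Zwegers' series times theta functions as double series -/

/-- The summand of `Theta`. -/
noncomputable def thetaTerm (j : ℤ) (k : ℕ) (τ z : ℂ) (n : ℤ) : ℂ :=
  qPow τ (k * ((n : ℂ) + (j : ℂ) / (2 * k)) ^ 2) *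
    exp (2 * Real.pi * I * k * ((n : ℂ) + (j : ℂ) / (2 * k)) * z)

theorem thetaTerm_eq {k : ℕ} (hk : 0 < k) (j : ℤ) (τ z : ℂ) (n : ℤ) :
    thetaTerm j k τ z n =
      exp (2 * Real.pi * I * ((j : ℂ) ^ 2 / (4 * k) * τ + j / 2 * z)) *
        jacobiTheta₂_term n (k * z + j * τ) (2 * k * τ) := by
  have hk' : (k : ℂ) ≠ 0 := by exact_mod_cast hk.ne'
  rw [thetaTerm, qPow, jacobiTheta₂_term, ← exp_add, ← exp_add]
  congr 1
  field_simp
  ring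

theorem summable_thetaTerm {k : ℕ} (hk : 0 < k) (j : ℤ) {τ : ℂ} (hτ : 0 < τ.im) (z : ℂ) :
    Summable (thetaTerm j k τ z) := by
  have h : 0 < (2 * k * τ : ℂ).im := by
    rw [show (2 * k * τ : ℂ) = ((2 * k : ℝ) : ℂ) * τ by push_cast; ring, im_ofReal_mul]
    positivity
  refine (((summable_jacobiTheta₂_term_iff (k * z + j * τ) _).mpr h).mul_left _).congr fun n =>
    (thetaTerm_eq hk j τ z n).symm

theorem thetaTerm_add {k : ℕ} (hk : 0 < k) (j l : ℤ) (τ z : ℂ) (n : ℤ) :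
    thetaTerm (j + 2 * k * l) k τ z n = thetaTerm j k τ z (n + l) := by
  have hk' : (k : ℂ) ≠ 0 := by exact_mod_cast hk.ne'
  have : (n : ℂ) + ((j + 2 * k * l : ℤ) : ℂ) / (2 * k) = ((n + l : ℤ) : ℂ) + j / (2 * k) := by
    push_cast
    field_simp
    ring
  rw [thetaTerm, thetaTerm, this]

theorem Theta_add {k : ℕ} (hk : 0 < k) (j l : ℤ) (τ z : ℂ) :
    Theta (j + 2 * k * l) k τ z = Theta j k τ z :=
  (tsum_congr (thetaTerm_add hk j l τ z)).trans ((Equiv.addRight l).tsum_eq (thetaTerm j k τ z))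

/-- By periodicity in j modulo 2k only 2k different sums occur. -/
theorem exists_tsum_norm_thetaTerm_le {k : ℕ} (hk : 0 < k) (τ z : ℂ) :
    ∃ C, ∀ j : ℤ, ∑' n, ‖thetaTerm j k τ z n‖ ≤ C := by
  set B : ℤ → ℝ := fun j => ∑' n, ‖thetaTerm j k τ z n‖ with hB
  have hB0 : ∀ j, 0 ≤ B j := fun j => tsum_nonneg fun n => norm_nonneg _
  refine ⟨∑ r ∈ Finset.range (2 * k), B r, fun j => ?_⟩
  have hk2 : (0 : ℤ) < 2 * k := by positivity
  have h0 := Int.emod_nonneg j hk2.ne'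
  have h1 := Int.emod_lt_of_pos j hk2
  have hj : B j = B ((j % (2 * k)).toNat : ℤ) := by
    conv_lhs => rw [← Int.emod_add_mul_ediv j (2 * k)]
    rw [Int.toNat_of_nonneg h0]
    simp only [hB, thetaTerm_add hk]
    exact (Equiv.addRight (j / (2 * k))).tsum_eq fun n => ‖thetaTerm (j % (2 * k)) k τ z n‖
  change B j ≤ _
  rw [hj]
  exact Finset.single_le_sum (f := fun r : ℕ => B r) (fun r _ => hB0 r)
    (Finset.mem_range.mpr (by omega))

theorem summable_zwegersTerm {N : ℕ} (hN : 0 < N) {τ : ℂ} (hτ : 0 < τ.im) (v : ℂ) :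
    Summable fun n : ℤ => zwegersTerm N n τ v := by
  have hY : 0 < τ.im / N := by positivity
  have hN' : (N : ℝ) ≠ 0 := by positivity
  refine .of_norm_bounded (summable_gaussian_mul_exp (T := τ.im / N / 4) (by positivity) |v.im|
    (2 * Real.exp (3 * Real.pi * (τ.im / N) * (2 * N * (v.im / τ.im)) ^ 2))) fun n => ?_
  rw [zwegersTerm, norm_mul, norm_real, Real.norm_eq_abs]
  have h1 : ‖exp (-(Real.pi * I * (n : ℂ) ^ 2 / (2 * N)) * τ - 2 * Real.pi * I * n * v)‖ ≤
      Real.exp (Real.pi * (τ.im / N / 2 * n ^ 2)) *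
        Real.exp (2 * Real.pi * |v.im| * |(n : ℝ)|) := by
    rw [norm_exp, ← Real.exp_add, Real.exp_le_exp]
    have : (-(Real.pi * I * (n : ℂ) ^ 2 / (2 * N)) * τ - 2 * Real.pi * I * n * v).re =
        Real.pi * (τ.im / N / 2 * n ^ 2) + 2 * Real.pi * (n * v.im) := by
      rw [show -(Real.pi * I * (n : ℂ) ^ 2 / (2 * N)) * τ - 2 * Real.pi * I * n * v =
        ((-(Real.pi * n ^ 2 / (2 * N)) : ℝ) : ℂ) * (I * τ) +
          ((-(2 * Real.pi * n) : ℝ) : ℂ) * (I * v) by push_cast; ring, add_re, re_ofReal_mul,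
        re_ofReal_mul, I_mul_re, I_mul_re]
      field_simp
    rw [this, mul_assoc (2 * Real.pi) |v.im|, mul_comm |v.im|, ← abs_mul]
    gcongr
    exact le_abs_self _
  refine (mul_le_mul (abs_signDefect_le hY n (2 * N * (v.im / τ.im))) h1 (norm_nonneg _)
    (by positivity)).trans (le_of_eq ?_)
  rw [← mul_assoc, mul_assoc (2 * _), ← Real.exp_add]
  congr 3
  ring

theorem summable_zwegersTerm_mul_thetaTerm {N : ℕ} (hN : 0 < N) {τ : ℂ} (hτ : 0 < τ.im) (v z : ℂ)
    (f : ℤ → ℤ) :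
    Summable fun p : ℤ × ℤ => zwegersTerm N p.1 τ v * thetaTerm (f p.1) N τ z p.2 := by
  obtain ⟨C, hC⟩ := exists_tsum_norm_thetaTerm_le hN τ z
  refine Summable.of_norm ((summable_prod_of_nonneg fun _ => norm_nonneg _).mpr ⟨fun n => ?_, ?_⟩)
  · simpa only [norm_mul] using (summable_thetaTerm hN (f n) hτ z).norm.mul_left _
  · refine .of_nonneg_of_le (fun n => tsum_nonneg fun _ => norm_nonneg _) (fun n => ?_)
      ((summable_zwegersTerm hN hτ v).norm.mul_right C)
    simp only [norm_mul, tsum_mul_left]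
    gcongr
    exact hC _

/-- The factors q^{n²/4N} and q^{−n²/4N} cancel, and the cross term of the theta exponent supplies
the shift of z₁ by aτ. -/
theorem zwegersTerm_mul_thetaTerm_neg {N : ℕ} (hN : 0 < N) {τ : ℂ} (hτ : 0 < τ.im) (z₁ z₂ : ℂ)
    (n a : ℤ) :
    zwegersTerm N n τ ((z₁ - z₂) / 2) * thetaTerm (-n) N τ (z₁ + z₂) a =
      diagMult N τ z₁ z₂ a * defectTerm (τ.im / N) (z₁ - z₂).im (z₁ + a * τ) n := by
  have hN' : (N : ℝ) ≠ 0 := by positivity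
  have hNc : (N : ℂ) ≠ 0 := by exact_mod_cast hN.ne'
  have harg : 2 * N * (((z₁ - z₂) / 2).im / τ.im) = (z₁ - z₂).im / (τ.im / N) := by
    simp
    field_simp
  rw [zwegersTerm, harg, ← signDefect, thetaTerm, qPow, diagMult, defectTerm, mul_assoc,
    mul_left_comm (exp _), ← exp_add, ← exp_add, mul_left_comm (exp _), ← exp_add]
  congr 2
  push_cast
  field_simp
  ring

/-- The mirror image, with n ↦ −n and z₁, z₂ exchanged. The extra 2 at n = 0 arises because sign(n +
1/2) is not odd there. -/
theorem zwegersTerm_mul_thetaTerm {N : ℕ} (hN : 0 < N) {τ : ℂ} (hτ : 0 < τ.im) (z₁ z₂ : ℂ)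
    (n a : ℤ) :
    zwegersTerm N n τ ((z₁ - z₂) / 2) * thetaTerm n N τ (z₁ + z₂) a =
      diagMult N τ z₁ z₂ a * ((if n = 0 then 2 else 0) -
        defectTerm (τ.im / N) (z₂ - z₁).im (z₂ + a * τ) (-n)) := by
  have hN' : (N : ℝ) ≠ 0 := by positivity
  have hNc : (N : ℂ) ≠ 0 := by exact_mod_cast hN.ne'
  have harg : ((n : ℝ) + 2 * N * (((z₁ - z₂) / 2).im / τ.im)) * √(τ.im / N) =
      -((((-n : ℤ) : ℝ) + (z₂ - z₁).im / (τ.im / N)) * √(τ.im / N)) := by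
    simp
    field_simp
    ring
  have hs : ∀ x, signDefect n (-x) = (if n = 0 then 2 else 0) - signDefect (-n) x := fun x => by
    simp only [signDefect, sign_intCast_add_half, zwegersE_neg]
    split_ifs <;> first | omega | ring
  have he : exp (-(Real.pi * I * (n : ℂ) ^ 2 / (2 * N)) * τ - 2 * Real.pi * I * n *
      ((z₁ - z₂) / 2)) * thetaTerm n N τ (z₁ + z₂) a =
      diagMult N τ z₁ z₂ a * exp (-(2 * Real.pi * I * ((-n : ℤ) : ℂ) * (z₂ + a * τ))) := by
    rw [thetaTerm, qPow, diagMult, ← exp_add, ← exp_add, ← exp_add]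
    congr 1
    push_cast
    field_simp
    ring
  rw [zwegersTerm, harg, ← signDefect, hs, mul_assoc, he, defectTerm]
  by_cases hn : n = 0
  · subst hn
    simp
    ring
  · simp only [if_neg hn]
    push_cast
    ring

/-- Theta depends only on its index modulo 2N, so the class sum defining R can be merged with the
sum over residues. -/
theorem sum_zwegersR_mul_Theta {N : ℕ} (hN : 0 < N) {τ : ℂ} (hτ : 0 < τ.im) (v z : ℂ) (σ : ℤ) :
    ∑ j ∈ Finset.range (2 * N), zwegersR N j τ v * Theta (σ * j) N τ z =
      ∑' p : ℤ × ℤ, zwegersTerm N p.1 τ v * thetaTerm (σ * p.1) N τ z p.2 := by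
  have hs := summable_zwegersTerm_mul_thetaTerm hN hτ v z (σ * ·)
  have h1 : ∀ n : ℤ, ∑' a, zwegersTerm N n τ v * thetaTerm (σ * n) N τ z a =
      zwegersTerm N n τ v * Theta (σ * n) N τ z := fun n => tsum_mul_left
  have hs1 := hs.prod
  rw [hs.tsum_prod]
  simp only [h1] at hs1 ⊢
  rw [← sum_range_tsum_int (M := 2 * N) (by positivity) hs1]
  refine Finset.sum_congr rfl fun j _ => ?_
  rw [zwegersR, ← tsum_mul_right]
  refine tsum_congr fun l => ?_
  have : σ * (j + ((2 * N : ℕ) : ℤ) * l) = σ * j + 2 * N * (σ * l) := by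
    push_cast
    ring
  rw [this, Theta_add hN]
  push_cast
  rfl

theorem summable_diagMult {N : ℕ} (hN : 0 < N) {τ : ℂ} (hτ : 0 < τ.im) (z₁ z₂ : ℂ) :
    Summable (diagMult N τ z₁ z₂) := by
  refine (summable_thetaTerm hN 0 hτ (z₁ + z₂)).congr fun a => ?_
  rw [thetaTerm, diagMult, qPow, ← exp_add]
  congr 1
  simp
  ring

theorem one_sub_exp_ne_zero {ζ : ℂ} (hζ : ∀ b : ℤ, ζ + b ≠ 0) :
    1 - exp (2 * Real.pi * I * ζ) ≠ 0 := fun h => by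
  obtain ⟨n, hn⟩ := exp_eq_one_iff.mp (sub_eq_zero.mp h).symm
  refine hζ (-n) ?_
  have : (2 * Real.pi * I : ℂ) * (ζ + (-n : ℤ)) = 0 := by
    push_cast
    linear_combination hn
  exact (mul_eq_zero.mp this).resolve_left two_pi_I_ne_zero

/-- The modified function `Φ̃` in terms of the Gaussian Kronecker series. -/
theorem PhiTilde_eq (m : ℕ) {τ : ℂ} (hτ : 0 < τ.im) {z₁ z₂ : ℂ}
    (hz₁ : ∀ p : ℤ × ℤ, z₁ + latPt τ 1 p ≠ 0) (hz₂ : ∀ p : ℤ × ℤ, z₂ + latPt τ 1 p ≠ 0) (t : ℂ) :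
    PhiTilde m τ z₁ z₂ t = exp (2 * Real.pi * I * (m + 1) * t) * (-(1 / (2 * Real.pi * I)) *
      (gauge (m + 1) τ z₁ z₂ * kernelSum (Real.pi * (m + 1 : ℕ) / τ.im) τ 1 z₁ z₂ +
        gauge (m + 1) τ z₂ z₁ * kernelSum (Real.pi * (m + 1 : ℕ) / τ.im) τ 1 z₂ z₁)) := by
  set N := m + 1 with hN
  have hN0 : 0 < N := m.succ_pos
  have hY : 0 < τ.im / N := by positivity
  have hNc : (N : ℂ) = m + 1 := by rw [hN]; push_cast; rfl
  have hsymm : ∀ a, diagMult N τ z₂ z₁ a = diagMult N τ z₁ z₂ a := fun a => by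
    rw [diagMult, diagMult, add_comm z₂]
  have hrow₁ := hasSum_diagMult_mul_row hN0 hτ hz₁ z₂
  have hrow₂ := hasSum_diagMult_mul_row hN0 hτ hz₂ z₁
  simp only [hsymm] at hrow₂
  have hQ := (summable_diagMult hN0 hτ z₁ z₂).hasSum
  set X₁ := -(1 / (2 * Real.pi * I)) *
    (gauge N τ z₁ z₂ * kernelSum (Real.pi * N / τ.im) τ 1 z₁ z₂)
  set X₂ := -(1 / (2 * Real.pi * I)) *
    (gauge N τ z₂ z₁ * kernelSum (Real.pi * N / τ.im) τ 1 z₂ z₁)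
  set v := (z₁ - z₂) / 2 with hv
  set Tneg := ∑ j ∈ Finset.range (2 * N), zwegersR N j τ v * Theta (-1 * j) N τ (z₁ + z₂) with hTn
  set Tpos := ∑ j ∈ Finset.range (2 * N), zwegersR N j τ v * Theta (1 * j) N τ (z₁ + z₂) with hTp
  have hneg : HasSum (fun a : ℤ => diagMult N τ z₁ z₂ a *
      ∑' n, defectTerm (τ.im / N) (z₁ - z₂).im (z₁ + a * τ) n) Tneg := by
    have hs := summable_zwegersTerm_mul_thetaTerm hN0 hτ v (z₁ + z₂) (-1 * ·)
    rw [hTn, sum_zwegersR_mul_Theta hN0 hτ v]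
    refine ((Equiv.prodComm ℤ ℤ).hasSum_iff.mpr hs.hasSum).prod_fiberwise fun a => ?_
    refine ((summable_defectTerm hY _ _).hasSum.mul_left _).congr_fun fun n => ?_
    simp only [Function.comp_apply, Equiv.prodComm_apply, Prod.swap_prod_mk, neg_one_mul]
    exact zwegersTerm_mul_thetaTerm_neg hN0 hτ z₁ z₂ n a
  have hpos : HasSum (fun a : ℤ => diagMult N τ z₁ z₂ a *
      (2 - ∑' n, defectTerm (τ.im / N) (z₂ - z₁).im (z₂ + a * τ) n)) Tpos := by
    have hs := summable_zwegersTerm_mul_thetaTerm hN0 hτ v (z₁ + z₂) (1 * ·)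
    rw [hTp, sum_zwegersR_mul_Theta hN0 hτ v]
    refine ((Equiv.prodComm ℤ ℤ).hasSum_iff.mpr hs.hasSum).prod_fiberwise fun a => ?_
    refine (((hasSum_ite_eq (0 : ℤ) (2 : ℂ)).sub ((Equiv.neg ℤ).hasSum_iff.mpr
      (summable_defectTerm hY _ _).hasSum)).mul_left _).congr_fun fun n => ?_
    simp only [Function.comp_apply, Equiv.prodComm_apply, Prod.swap_prod_mk, one_mul]
    exact zwegersTerm_mul_thetaTerm hN0 hτ z₁ z₂ n a
  -- The completions cancel row by row. With x, y the exponentials of z₁ + aτ and z₂ + aτ, what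
  -- remains is the multiplier times 1/(1−x), and times 1/(1−y) − 1 = −1/(1−y⁻¹). These are the two
  -- parts of Φ, the second under a ↦ −a.
  have hA := (hrow₁.add hQ).sub (hneg.mul_left (1 / 2))
  have hB := (hrow₂.sub hQ).add (hpos.mul_left (1 / 2))
  have hPhi : HasSum (fun j : ℤ =>
      (exp (2 * Real.pi * I * j * (m + 1) * (z₁ + z₂)) * qPow τ ((j : ℂ) ^ 2 * (m + 1)) /
          (1 - exp (2 * Real.pi * I * z₁) * qPow τ j) -
        exp (-(2 * Real.pi * I * j * (m + 1) * (z₁ + z₂))) * qPow τ ((j : ℂ) ^ 2 * (m + 1)) /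
          (1 - exp (-(2 * Real.pi * I * z₂)) * qPow τ j)))
      ((X₁ + ∑' a, diagMult N τ z₁ z₂ a - 1 / 2 * Tneg) +
        (X₂ - ∑' a, diagMult N τ z₁ z₂ a + 1 / 2 * Tpos)) := by
    refine (hA.add ((Equiv.neg ℤ).hasSum_iff.mpr hB)).congr_fun fun j => ?_
    have h1 : exp (2 * Real.pi * I * j * (m + 1) * (z₁ + z₂)) * qPow τ ((j : ℂ) ^ 2 * (m + 1)) =
        diagMult N τ z₁ z₂ j := by
      rw [qPow, diagMult, ← exp_add, hNc]
      congr 1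
      ring
    have h2 : exp (-(2 * Real.pi * I * j * (m + 1) * (z₁ + z₂))) *
        qPow τ ((j : ℂ) ^ 2 * (m + 1)) = diagMult N τ z₁ z₂ (-j) := by
      rw [qPow, diagMult, ← exp_add, hNc]
      congr 1
      push_cast
      ring
    have h3 : exp (2 * Real.pi * I * z₁) * qPow τ j = exp (2 * Real.pi * I * (z₁ + j * τ)) := by
      rw [qPow, ← exp_add]
      congr 1
      ring
    have h4 : exp (-(2 * Real.pi * I * z₂)) * qPow τ j =
        (exp (2 * Real.pi * I * (z₂ + (-j : ℤ) * τ)))⁻¹ := by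
      rw [qPow, ← exp_add, ← exp_neg]
      congr 1
      push_cast
      ring
    have h5 := one_sub_exp_ne_zero (ζ := z₂ + (-j : ℤ) * τ) fun b => by
      simpa [latPt, add_assoc] using hz₂ (-j, b)
    have h6 := exp_ne_zero (2 * Real.pi * I * (z₂ + (-j : ℤ) * τ))
    simp only [Function.comp_apply, Equiv.neg_apply]
    rw [h1, h2, h3, h4]
    generalize exp (2 * Real.pi * I * (z₂ + (-j : ℤ) * τ)) = x at h5 h6 ⊢
    have h7 : 1 - x⁻¹ ≠ 0 := fun h => h5 (by
      field_simp at h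
      linear_combination -h)
    have h8 : 1 / (1 - x) = 1 - 1 / (1 - x⁻¹) := by
      have : x - 1 ≠ 0 := fun h => h5 (by linear_combination -h)
      field_simp
      ring
    rw [h8]
    ring
  have hAdd : ∑ j ∈ Finset.range (2 * m + 2), zwegersR (m + 1) (j : ℤ) τ ((z₁ - z₂) / 2) *
        (Theta (j : ℤ) (m + 1) τ (z₁ + z₂) - Theta (-(j : ℤ)) (m + 1) τ (z₁ + z₂)) =
      Tpos - Tneg := by
    rw [hTp, hTn, ← Finset.sum_sub_distrib]
    refine Finset.sum_congr rfl fun j _ => ?_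
    rw [one_mul, neg_one_mul, mul_sub]
  rw [PhiTilde, Phi, PhiAdd, hPhi.tsum_eq, hAdd, mul_add (-(1 / (2 * Real.pi * I) : ℂ))]
  change _ = exp _ * (X₁ + X₂)
  ring

/-! ### Modular inversion of the affine denominators -/

/-- Splitting the Jacobi series by the parity of n gives the two degree 2 series; the half period
b/2 contributes the sign (−1)^{bn}. -/
theorem Theta_add_neg_one_pow_mul_Theta (a b : ℕ) {τ : ℂ} (hτ : 0 < τ.im) (z : ℂ) :
    Theta a 2 τ z + (-1) ^ b * Theta (a + 2) 2 τ z =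
      exp (Real.pi * I * ((a : ℂ) ^ 2 * τ / 4 + a * z)) *
        jacobiTheta₂ (z + a * τ / 2 + b / 2) τ := by
  have hs : Summable fun n : ℤ => jacobiTheta₂_term n (z + a * τ / 2 + b / 2) τ :=
    (summable_jacobiTheta₂_term_iff _ τ).mpr hτ
  have hterm : ∀ p : ℕ, (-1) ^ (b * p) * Theta (a + 2 * p) 2 τ z =
      exp (Real.pi * I * ((a : ℂ) ^ 2 * τ / 4 + a * z)) *
        ∑' c : ℤ, jacobiTheta₂_term (p + (2 : ℕ) * c) (z + a * τ / 2 + b / 2) τ := fun p => by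
    rw [Theta, ← tsum_mul_left, ← tsum_mul_left]
    refine tsum_congr fun c => ?_
    rw [← exp_pi_mul_I, ← exp_nat_mul, qPow, jacobiTheta₂_term, ← exp_add, ← exp_add, ← exp_add,
      exp_eq_exp_iff_exists_int]
    refine ⟨-(b * c), ?_⟩
    push_cast
    field_simp
    ring
  have h := sum_range_tsum_int (M := 2) (by norm_num) hs
  rw [jacobiTheta₂, ← h, Finset.mul_sum, Finset.sum_congr rfl fun p _ => (hterm p).symm]
  simp [Finset.sum_range_succ]

theorem vartheta_eq (a b : Fin 2) {τ : ℂ} (hτ : 0 < τ.im) (z : ℂ) :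
    vartheta a b τ z = I ^ ((a : ℕ) * b) *
      (exp (Real.pi * I * (((a : ℕ) : ℂ) ^ 2 * τ / 4 + (a : ℕ) * z)) *
        jacobiTheta₂ (z + (a : ℕ) * τ / 2 + (b : ℕ) / 2) τ) := by
  have h1 : Theta (-1) 2 τ z = Theta 3 2 τ z := (Theta_add two_pos (-1) 1 τ z).symm.trans (by norm_num)
  rw [← Theta_add_neg_one_pow_mul_Theta a b hτ z]
  fin_cases a <;> fin_cases b <;> simp [vartheta, h1] <;> ring

theorem vartheta_neg_inv (a b : Fin 2) {τ : ℂ} (hτ : 0 < τ.im) (z : ℂ) :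
    vartheta a b (-1 / τ) (z / τ) = (-I) ^ ((a : ℕ) * b) * ((-I * τ) ^ (1 / 2 : ℂ) *
      exp (Real.pi * I * z ^ 2 / τ)) * vartheta b a τ z := by
  have hτ0 : τ ≠ 0 := fun h => by simp [h] at hτ
  have hτ' : 0 < (-1 / τ).im := by
    rw [neg_div, neg_im, one_div, inv_im, neg_div, neg_neg]
    exact div_pos hτ (normSq_pos.mpr hτ0)
  have hs : (-I * τ) ^ (1 / 2 : ℂ) ≠ 0 := by
    rw [Ne, cpow_eq_zero_iff]
    simp [hτ0]
  rw [vartheta_eq a b hτ', vartheta_eq b a hτ]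
  generalize ha : (a : ℕ) = a' at *
  generalize hb : (b : ℕ) = b' at *
  -- The functional equation produces −a/2 in place of a/2; the two differ by the integer period a.
  have hper : jacobiTheta₂ (z + b' * τ / 2 + a' / 2) τ =
      jacobiTheta₂ (z + b' * τ / 2 - a' / 2) τ := by
    have : a' = 0 ∨ a' = 1 := by omega
    rcases this with rfl | rfl
    · simp
    · rw [← jacobiTheta₂_add_left (z + b' * τ / 2 - _)]
      congr 1
      push_cast
      ring
  have harg : (z + b' * τ / 2 - a' / 2) / τ = z / τ + a' * (-1 / τ) / 2 + b' / 2 := by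
    field_simp
    ring
  have hsq : ∀ x : ℕ, x = 0 ∨ x = 1 → (x : ℂ) ^ 2 = x := by
    rintro x (rfl | rfl) <;> simp
  have ha2 := hsq a' (by omega)
  have hb2 := hsq b' (by omega)
  rw [hper, jacobiTheta₂_functional_equation (z + b' * τ / 2 - a' / 2) τ, harg]
  generalize jacobiTheta₂ (z / τ + a' * (-1 / τ) / 2 + b' / 2) (-1 / τ) = J
  have hI : I ^ (a' * b') = exp (Real.pi / 2 * I * (a' * b')) := by
    have h := exp_nat_mul (Real.pi / 2 * I) (a' * b')
    rw [exp_pi_div_two_mul_I] at h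
    rw [← h]
    push_cast
    ring_nf
  have hI' : (-I) ^ (a' * b') * I ^ (b' * a') = 1 := by
    rw [mul_comm b', ← mul_pow]
    simp
  have hexp : exp (Real.pi * I * z ^ 2 / τ) * exp (Real.pi * I * ((b' : ℂ) ^ 2 * τ / 4 + b' * z)) *
      exp (-Real.pi * I * (z + b' * τ / 2 - a' / 2) ^ 2 / τ) =
      I ^ (a' * b') * exp (Real.pi * I * ((a' : ℂ) ^ 2 * (-1 / τ) / 4 + a' * (z / τ))) := by
    rw [hI, ← exp_add, ← exp_add, ← exp_add]
    congr 1
    field_simp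
    ring
  rw [← mul_assoc, ← hexp]
  generalize exp (Real.pi * I * z ^ 2 / τ) = E₀
  generalize exp (Real.pi * I * ((b' : ℂ) ^ 2 * τ / 4 + b' * z)) = E₁
  generalize exp (-Real.pi * I * (z + b' * τ / 2 - a' / 2) ^ 2 / τ) = E₂
  generalize (-I) ^ (a' * b') = x at hI' ⊢
  generalize I ^ (b' * a') = y at hI' ⊢
  field_simp
  linear_combination -(E₀ * E₁ * E₂ * J) * hI'

theorem eta_neg_inv_pow_four {τ : ℂ} (hτ : 0 < τ.im) :
    ModularForm.eta (-1 / τ) ^ 4 = -τ ^ 2 * ModularForm.eta τ ^ 4 := by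
  have h := ModularForm.eta_comp_eq_csqrt_I_inv hτ
  have hsq : ∀ z : ℂ, z.sqrt ^ 2 = z := fun z => by
    simp [Complex.sqrt]
  simp only [Function.comp_apply, Pi.smul_apply, Pi.mul_apply, smul_eq_mul] at h
  rw [h, mul_pow, mul_pow, inv_pow, show 4 = 2 * 2 by norm_num, pow_mul I.sqrt, pow_mul τ.sqrt,
    hsq, hsq, I_sq]
  ring

/-- Inversion swaps the theta characteristics, hence e and e'. The Gaussian factors cancel because
(z₁−z₂)² + (z₁+z₂)² = 2z₁² + 2z₂², and the weights leave one factor iτ. -/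
theorem Rhat_neg_inv (e e' : Fin 2) {τ : ℂ} (hτ : 0 < τ.im) (z₁ z₂ : ℂ) :
    Rhat e e' (-1 / τ) (z₁ / τ) (z₂ / τ) =
      (-1) ^ (e : ℕ) * (-1) ^ (e' : ℕ) * (I * τ) * Rhat e' e τ z₁ z₂ := by
  have hτ0 : τ ≠ 0 := fun h => by simp [h] at hτ
  have hs : ((-I * τ) ^ (1 / 2 : ℂ)) ^ 2 = -I * τ := by
    rw [← cpow_nat_mul]
    norm_num
  have hsign : ∀ n : ℕ, ((-I) ^ n) ^ 4 = 1 := fun n => by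
    rw [← pow_mul, mul_comm, pow_mul]
    have : (-I) ^ 4 = 1 := by rw [neg_pow, I_pow_four]; norm_num
    rw [this, one_pow]
  have he : ((-1 : ℂ) ^ (e : ℕ)) ^ 2 = 1 := by rw [← pow_mul, mul_comm, pow_mul]; norm_num
  rw [Rhat, Rhat, ← sub_div, ← add_div, eta_neg_inv_pow_four hτ]
  simp only [vartheta_neg_inv _ _ hτ]
  generalize hn : (((1 - e' : Fin 2) : ℕ) * ((1 - e : Fin 2) : ℕ)) = n
  have hsn := hsign n
  set x := (-I) ^ n
  set s := (-I * τ) ^ (1 / 2 : ℂ)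
  have hexp : exp (Real.pi * I * (z₁ - z₂) ^ 2 / τ) * exp (Real.pi * I * (z₁ + z₂) ^ 2 / τ) =
      exp (Real.pi * I * z₁ ^ 2 / τ) ^ 2 * exp (Real.pi * I * z₂ ^ 2 / τ) ^ 2 := by
    rw [← exp_nat_mul, ← exp_nat_mul, ← exp_add, ← exp_add]
    congr 1
    push_cast
    ring
  have hE1 := exp_ne_zero (Real.pi * I * z₁ ^ 2 / τ)
  have hE2 := exp_ne_zero (Real.pi * I * z₂ ^ 2 / τ)
  set E₁ := exp (Real.pi * I * z₁ ^ 2 / τ)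
  set E₂ := exp (Real.pi * I * z₂ ^ 2 / τ)
  set F₁ := exp (Real.pi * I * (z₁ - z₂) ^ 2 / τ)
  set F₂ := exp (Real.pi * I * (z₁ + z₂) ^ 2 / τ)
  generalize vartheta (1 - e) (1 - e') τ z₁ = A
  generalize vartheta (1 - e) (1 - e') τ z₂ = B
  generalize vartheta 1 1 τ (z₁ - z₂) = C
  generalize vartheta 1 1 τ (z₁ + z₂) = D
  have hden : (x * (s * E₁) * A) ^ 2 * (x * (s * E₂) * B) ^ 2 =
      (-τ ^ 2 * (E₁ ^ 2 * E₂ ^ 2)) * (A ^ 2 * B ^ 2) := by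
    calc _ = x ^ 4 * (s ^ 2) ^ 2 * (E₁ ^ 2 * E₂ ^ 2) * (A ^ 2 * B ^ 2) := by ring
      _ = _ := by
        rw [hsn, hs]
        linear_combination τ ^ 2 * (E₁ ^ 2 * E₂ ^ 2) * (A ^ 2 * B ^ 2) * I_sq
  have hnum : (-I) ^ (((1 : Fin 2) : ℕ) * ((1 : Fin 2) : ℕ)) * (s * F₁) * C *
      ((-I) ^ (((1 : Fin 2) : ℕ) * ((1 : Fin 2) : ℕ)) * (s * F₂) * D) =
      (E₁ ^ 2 * E₂ ^ 2) * (I * τ) * (C * D) := by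
    rw [show ((1 : Fin 2) : ℕ) * ((1 : Fin 2) : ℕ) = 1 from rfl, pow_one]
    calc _ = I ^ 2 * s ^ 2 * (F₁ * F₂) * (C * D) := by ring
      _ = _ := by rw [hs, hexp, I_sq]; ring
  rw [hnum, hden]
  have hτ2 : -τ ^ 2 * (E₁ ^ 2 * E₂ ^ 2) ≠ 0 := by
    simp [hτ0, hE1, hE2]
  rw [show (-1) ^ (e' : ℕ) * (-τ ^ 2 * ModularForm.eta τ ^ 4) * (E₁ ^ 2 * E₂ ^ 2 * (I * τ) * (C * D))
    = (-τ ^ 2 * (E₁ ^ 2 * E₂ ^ 2)) * ((-1) ^ (e' : ℕ) * ModularForm.eta τ ^ 4 * (I * τ) * (C * D)) by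
      ring, mul_div_mul_left _ _ hτ2, ← mul_div_assoc]
  congr 1
  linear_combination (-(-1) ^ (e' : ℕ) * ModularForm.eta τ ^ 4 * (I * τ) * (C * D)) * he

/-! ### Transformation laws of `Ψ̃` -/

/-- The Gaussian parameter of index `N` at the lattice `ℤMτ + ℤ`. -/
noncomputable def gaussParam (M N : ℕ) (τ : ℂ) : ℝ := Real.pi * N / (M * τ).im

/-- One of the two halves of `Ψ̃`, as a Gaussian Kronecker series. -/
noncomputable def psiHalf (M N : ℕ) (ε j k : ℚ) (τ z₁ z₂ : ℂ) : ℂ :=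
  exp (2 * Real.pi * I * (N / M) * (j * k * τ + k * z₁ + j * z₂)) *
    (gauge N (M * τ) (z₁ + j * τ + ε) (z₂ + k * τ + ε) *
      kernelSum (gaussParam M N τ) (M * τ) 1 (z₁ + j * τ + ε) (z₂ + k * τ + ε))

theorem natCast_mul_im (M : ℕ) (τ : ℂ) : (M * τ : ℂ).im = M * τ.im := by
  rw [← ofReal_natCast, im_ofReal_mul]

theorem gaussParam_pos {M N : ℕ} (hM : 0 < M) (hN : 0 < N) {τ : ℂ} (hτ : 0 < τ.im) :
    0 < gaussParam M N τ := by
  have := Real.pi_pos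
  rw [gaussParam, natCast_mul_im]
  positivity

theorem gaussParam_mul {M : ℕ} (hM : 0 < M) (N : ℕ) {τ : ℂ} (hτ : 0 < τ.im) :
    gaussParam M N τ * (M * τ.im) = Real.pi * N := by
  rw [gaussParam, natCast_mul_im]
  field_simp

theorem ofReal_gaussParam {M : ℕ} (hM : 0 < M) (N : ℕ) {τ : ℂ} (hτ : 0 < τ.im) :
    (gaussParam M N τ : ℂ) = 2 * Real.pi * I * N / (M * (τ - conj τ)) := by
  have hMc : (M : ℂ) ≠ 0 := by exact_mod_cast hM.ne'
  have h := sub_conj_ne_zero hτ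
  rw [gaussParam, natCast_mul_im]
  push_cast
  rw [ofReal_im_eq]
  field_simp

theorem neg_one_div_im_pos {τ : ℂ} (hτ : 0 < τ.im) : 0 < (-1 / τ).im := by
  rw [neg_div, neg_im, one_div, inv_im, neg_div, neg_neg]
  exact div_pos hτ (normSq_pos.mpr fun h => by simp [h] at hτ)

theorem PsiTilde_eq {M : ℕ} (hM : 0 < M) (m : ℕ) (e : Fin 2) (j k : ℚ) {τ : ℂ} (hτ : 0 < τ.im)
    {z₁ z₂ : ℂ} (hz₁ : ∀ p : ℤ × ℤ, z₁ + j * τ + (half e : ℂ) + latPt (M * τ) 1 p ≠ 0)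
    (hz₂ : ∀ p : ℤ × ℤ, z₂ + k * τ + (half e : ℂ) + latPt (M * τ) 1 p ≠ 0) (t : ℂ) :
    PsiTilde M m e j k τ z₁ z₂ t = exp (2 * Real.pi * I * ((m + 1 : ℕ) / M) * t) *
      (-(1 / (2 * Real.pi * I)) * (psiHalf M (m + 1) (half e) j k τ z₁ z₂ +
        psiHalf M (m + 1) (half e) k j τ z₂ z₁)) := by
  have hMτ : 0 < (M * τ : ℂ).im := by
    rw [natCast_mul_im]
    positivity
  have h1 : qPow τ ((m + 1) * j * k / M) * exp (2 * Real.pi * I * (m + 1) / M * (k * z₁ + j * z₂)) =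
      exp (2 * Real.pi * I * ((m + 1 : ℕ) / M) * (j * k * τ + k * z₁ + j * z₂)) := by
    rw [qPow, ← exp_add]
    congr 1
    push_cast
    ring
  have h2 : exp (2 * Real.pi * I * ((m + 1 : ℕ) / M) * (k * j * τ + j * z₂ + k * z₁)) =
      exp (2 * Real.pi * I * ((m + 1 : ℕ) / M) * (j * k * τ + k * z₁ + j * z₂)) := by
    congr 1
    ring
  have h3 : exp (2 * Real.pi * I * (m + 1) * (t / M)) =
      exp (2 * Real.pi * I * ((m + 1 : ℕ) / M) * t) := by
    congr 1
    push_cast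
    ring
  rw [PsiTilde, h1, PhiTilde_eq m hMτ hz₁ hz₂, h3, psiHalf, psiHalf, h2]
  simp only [gaussParam]
  ring

/-- Merging the prefactor with the gauge leaves k in the exponent only through the phase of −εk;
otherwise k enters just as a translation in the kernel. -/
theorem psiHalf_eq {M : ℕ} (hM : 0 < M) (N : ℕ) (ε j k : ℚ) {τ : ℂ} (hτ : 0 < τ.im) (z₁ z₂ : ℂ) :
    psiHalf M N ε j k τ z₁ z₂ =
      exp (2 * Real.pi * I * (N / M) * (j * ((τ * conj z₂ - conj τ * z₂) / (τ - conj τ)) -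
        (z₁ + ε) * ((z₂ - conj z₂) / (τ - conj τ)) - ε * k)) *
      kernelSum (gaussParam M N τ) (M * τ) 1 (z₁ + j * τ + ε) (z₂ + k * τ + ε) := by
  have hMc : (M : ℂ) ≠ 0 := by exact_mod_cast hM.ne'
  have h := sub_conj_ne_zero hτ
  rw [psiHalf, gauge, ← mul_assoc, ← exp_add]
  congr 2
  simp only [map_add, map_mul, map_natCast, map_ratCast]
  have h' : (M : ℂ) * τ - M * conj τ ≠ 0 := by
    rw [← mul_sub]
    exact mul_ne_zero hMc h
  generalize conj τ = τ' at h h' ⊢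
  generalize conj z₂ = z₂'
  field_simp
  ring

theorem psiHalf_add_mul {M : ℕ} (hM : 0 < M) (N : ℕ) (ε j k : ℚ) (n n' : ℤ) {τ : ℂ}
    (hτ : 0 < τ.im) (z₁ z₂ : ℂ) :
    psiHalf M N ε (j + n * M) (k + n' * M) τ z₁ z₂ =
      exp (-(2 * Real.pi * I * N * ε * (n + n'))) * psiHalf M N ε j k τ z₁ z₂ := by
  have hMc : (M : ℂ) ≠ 0 := by exact_mod_cast hM.ne'
  have h := sub_conj_ne_zero hτ
  have hκ : gaussParam M N τ * ((M * τ) * conj (1 : ℂ)).im = Real.pi * N := by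
    rw [map_one, mul_one, natCast_mul_im, gaussParam_mul hM N hτ]
  have h1 : ∀ (z : ℂ) (x : ℚ) (y : ℤ), z + ((x + y * M : ℚ) : ℂ) * τ + ε =
      z + x * τ + ε + latPt (M * τ) 1 (y, 0) := fun z x y => by
    simp only [latPt]
    push_cast
    ring
  rw [psiHalf_eq hM N _ _ _ hτ, psiHalf_eq hM N _ _ _ hτ, h1, h1, kernelSum_add_latPt hκ,
    ← mul_assoc, ← mul_assoc, ← exp_add, ← exp_add, ofReal_gaussParam hM N hτ]
  congr 2
  simp only [latPt, map_add, map_mul, map_natCast, map_ratCast, map_intCast, map_one]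
  generalize conj τ = τ' at h ⊢
  generalize conj z₂ = z₂'
  push_cast
  field_simp
  ring

/-- Rescaling by τ turns ℤ(−M/τ)+ℤ into ℤτ+ℤM, which `kernelSum_isogeny` expresses through ℤMτ+ℤ.
The shifts −j and ε' differ by integers r, which are lattice points and cost only the phases of the
Fourier sum. -/
theorem psiHalf_neg_inv {M N : ℕ} (hM : 0 < M) (hN : 0 < N) (hgcd : Nat.gcd M N = 1)
    {ε ε' j k : ℚ} {r r' : ℤ} (hj : ε' + j = r) (hk : ε' + k = r') {σ σ' : ℤ} (hσ : σ * σ = 1)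
    (hσ' : σ' * σ' = 1) {τ : ℂ} (hτ : 0 < τ.im) {z₁ : ℂ}
    (hz : ∀ p : ℤ × ℤ, z₁ - j + ε * τ + latPt τ 1 p ≠ 0) (z₂ : ℂ) :
    psiHalf M N ε j k (-1 / τ) (z₁ / τ) (z₂ / τ) =
      τ / M * exp (2 * Real.pi * I * (N / M) * (z₁ * z₂ / τ)) *
        ∑ p ∈ Finset.range M, ∑ s ∈ Finset.range M,
          exp (-(2 * Real.pi * I * (N / M) *
              ((ε + (σ * p : ℤ) : ℚ) * k + (ε + (σ' * s : ℤ) : ℚ) * j))) *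
            psiHalf M N ε' (ε + (σ * p : ℤ)) (ε + (σ' * s : ℤ)) τ z₁ z₂ := by
  have hMc : (M : ℂ) ≠ 0 := by exact_mod_cast hM.ne'
  have hτ0 : τ ≠ 0 := fun h => by simp [h] at hτ
  have hτc0 : conj τ ≠ 0 := (map_ne_zero _).mpr hτ0
  have h := sub_conj_ne_zero hτ
  have hτ' := neg_one_div_im_pos hτ
  have h' := sub_conj_ne_zero hτ'
  have hκ : gaussParam M N τ * ((M * τ) * conj (1 : ℂ)).im = Real.pi * N := by
    rw [map_one, mul_one, natCast_mul_im, gaussParam_mul hM N hτ]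
  have hjc : (ε' : ℂ) + j = r := by exact_mod_cast hj
  have hkc : (ε' : ℂ) + k = r' := by exact_mod_cast hk
  set u₁ := z₁ - j + ε * τ
  set u₂ := z₂ - k + ε * τ with hu₂
  have hS : kernelSum (gaussParam M N (-1 / τ)) (M * (-1 / τ)) 1 (z₁ / τ + j * (-1 / τ) + ε)
      (z₂ / τ + k * (-1 / τ) + ε) = τ * kernelSum (gaussParam M N τ) τ M u₁ u₂ := by
    have h1 := kernelSum_smul (gaussParam M N τ) (inv_ne_zero hτ0) (-M) τ u₁ u₂
    rw [kernelSum_rotate, inv_inv] at h1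
    rw [← h1]
    congr 1
    · rw [gaussParam, gaussParam, natCast_mul_im, natCast_mul_im, neg_div, neg_im, one_div, inv_im,
        map_inv₀]
      field_simp
    · field_simp
    · field_simp
    · simp only [u₁]
      field_simp
      ring
    · simp only [u₂]
      field_simp
      ring
  have hterm : ∀ P S : ℤ,
      exp (2 * Real.pi * I * (N / M) * (j * ((-1 / τ * conj (z₂ / τ) - conj (-1 / τ) * (z₂ / τ)) /
          (-1 / τ - conj (-1 / τ))) - (z₁ / τ + ε) * ((z₂ / τ - conj (z₂ / τ)) /
            (-1 / τ - conj (-1 / τ))) - ε * k)) *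
        (exp (gaussParam M N τ * (P * (τ * conj u₂ - conj τ * u₂))) *
          kernelSum (gaussParam M N τ) (M * τ) 1 (u₁ + P * τ) (u₂ + S * τ)) =
      exp (2 * Real.pi * I * (N / M) * (z₁ * z₂ / τ)) *
        (exp (-(2 * Real.pi * I * (N / M) * ((ε + P : ℚ) * k + (ε + S : ℚ) * j))) *
          psiHalf M N ε' (ε + P) (ε + S) τ z₁ z₂) := fun P S => by
    have h1 : z₁ + ((ε + P : ℚ) : ℂ) * τ + ε' = u₁ + P * τ + latPt (M * τ) 1 (0, r) := by
      simp only [latPt, u₁, ← hjc]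
      push_cast
      ring
    have h2 : z₂ + ((ε + S : ℚ) : ℂ) * τ + ε' = u₂ + S * τ + latPt (M * τ) 1 (0, r') := by
      simp only [latPt, u₂, ← hkc]
      push_cast
      ring
    rw [psiHalf_eq hM N _ _ _ hτ, h1, h2, kernelSum_add_latPt hκ]
    simp only [← mul_assoc, ← exp_add]
    congr 2
    rw [ofReal_gaussParam hM N hτ]
    simp only [latPt, ← hjc, hu₂, map_add, map_sub, map_mul, map_div₀, map_neg,
      map_ratCast, map_intCast, map_one, Int.cast_zero, zero_mul, zero_add, mul_one] at h' ⊢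
    generalize conj τ = τ' at *
    generalize conj z₂ = z₂'
    have h3 : -1 / τ - -1 / τ' = (τ - τ') / (τ * τ') := by
      field_simp
      ring
    rw [h3]
    push_cast
    field_simp
    ring
  rw [psiHalf_eq hM N _ _ _ hτ', hS]
  have hiso := kernelSum_isogeny (gaussParam_pos hM hN hτ) hM hgcd hτ (gaussParam_mul hM N hτ)
    hσ hσ' hz u₂
  have hsum := congrArg (exp (2 * Real.pi * I * (N / M) * (j * ((-1 / τ * conj (z₂ / τ) -
    conj (-1 / τ) * (z₂ / τ)) / (-1 / τ - conj (-1 / τ))) - (z₁ / τ + ε) * ((z₂ / τ -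
      conj (z₂ / τ)) / (-1 / τ - conj (-1 / τ))) - ε * k)) * ·) hiso
  simp only [Finset.mul_sum, hterm] at hsum
  simp only [← Finset.mul_sum] at hsum
  generalize exp (2 * Real.pi * I * (N / M) * (j * ((-1 / τ * conj (z₂ / τ) -
    conj (-1 / τ) * (z₂ / τ)) / (-1 / τ - conj (-1 / τ))) - (z₁ / τ + ε) * ((z₂ / τ -
      conj (z₂ / τ)) / (-1 / τ - conj (-1 / τ))) - ε * k)) = X at hsum ⊢
  rw [mul_assoc (τ / M), hsum]
  field_simp

/-! ### Poles, and the inversion law of Ψ̃ -/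

/-- `z` is not an `(ε', ε)`-shifted lattice point. -/
def OffLattice (e e' : Fin 2) (τ z : ℂ) : Prop :=
  ∀ r s : ℤ, z ≠ (half e : ℂ) + r + ((half e' : ℂ) + s) * τ

theorem two_mul_half (e : Fin 2) : (2 * half e : ℚ) = ((e : ℕ) : ℤ) := by
  rw [half]
  push_cast
  ring

theorem OffLattice.add_latPt_ne_zero {e e' : Fin 2} {τ z : ℂ} (hz : OffLattice e' e τ z) (M : ℕ)
    {a : ℚ} {n : ℤ} (ha : a = half e + n) (p : ℤ × ℤ) :
    z + a * τ + (half e' : ℂ) + latPt (M * τ) 1 p ≠ 0 := fun h => by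
  have h1 : (2 * half e : ℂ) = ((e : ℕ) : ℤ) := by exact_mod_cast two_mul_half e
  have h2 : (2 * half e' : ℂ) = ((e' : ℕ) : ℤ) := by exact_mod_cast two_mul_half e'
  -- The terms e and e' convert −1/2 into 1/2 modulo ℤ.
  refine hz (-p.2 - (e' : ℕ)) (-n - p.1 * M - (e : ℕ)) ?_
  rw [ha] at h
  simp only [latPt] at h
  push_cast at h h1 h2 ⊢
  linear_combination h - h1 * τ - h2

theorem OffLattice.sub_add_latPt_ne_zero {e e' : Fin 2} {τ z : ℂ} (hz : OffLattice e' e τ z)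
    {j : ℚ} {n : ℤ} (hj : j = half e' + n) (p : ℤ × ℤ) :
    z - j + (half e : ℚ) * τ + latPt τ 1 p ≠ 0 := fun h => by
  have h1 : (2 * half e : ℂ) = ((e : ℕ) : ℤ) := by exact_mod_cast two_mul_half e
  refine hz (n - p.2) (-p.1 - (e : ℕ)) ?_
  rw [hj] at h
  simp only [latPt] at h
  push_cast at h h1 ⊢
  linear_combination h - h1 * τ

theorem OffLattice.neg_inv_add_latPt_ne_zero {e e' : Fin 2} {τ z : ℂ} (hτ : 0 < τ.im)
    (hz : OffLattice e' e τ z) (M : ℕ) {j : ℚ} {n : ℤ} (hj : j = half e' + n) (p : ℤ × ℤ) :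
    z / τ + j * (-1 / τ) + (half e : ℂ) + latPt (M * (-1 / τ)) 1 p ≠ 0 := fun h => by
  have hτ0 : τ ≠ 0 := fun h => by simp [h] at hτ
  refine hz.sub_add_latPt_ne_zero hj (p.2, -p.1 * M) ?_
  simp only [latPt] at h ⊢
  push_cast
  field_simp at h
  linear_combination h

theorem OffLattice.eventually {e e' : Fin 2} {τ z : ℂ} (hτ : 0 < τ.im)
    (hz : OffLattice e' e τ z) : ∀ᶠ z' in nhds z, OffLattice e' e τ z' := by
  have h0 : ∀ p : ℤ × ℤ, z - (half e' + half e * τ) + latPt τ 1 p ≠ 0 := fun p h => by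
    refine hz (-p.2) (-p.1) ?_
    simp only [latPt] at h
    push_cast
    linear_combination h
  have hc : Filter.Tendsto (fun z' : ℂ => z' - (half e' + half e * τ)) (nhds z)
      (nhds (z - (half e' + half e * τ))) := (continuous_sub_right _).tendsto z
  filter_upwards [hc.eventually (eventually_add_latPt_ne_zero hτ h0)] with z' hz' r s h
  refine hz' (-s, -r) ?_
  rw [h]
  simp only [latPt]
  push_cast
  ring

/-- The second half has z₁, z₂ and the two indices exchanged, so the opposite signs σ, σ' make both
halves run over the same index pairs. The common factor in z₁z₂/τ is absorbed into t. -/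
theorem PsiTilde_neg_inv {M m : ℕ} (hM : 0 < M) (hgcd : Nat.gcd M (m + 1) = 1) {e e' : Fin 2}
    {j k : ℚ} {n n' : ℤ} (hj : j = half e' + n) (hk : k = half e' + n') {τ : ℂ} (hτ : 0 < τ.im)
    {z₁ z₂ : ℂ} (hz₁ : OffLattice e' e τ z₁) (hz₂ : OffLattice e' e τ z₂) (t : ℂ) :
    PsiTilde M m e j k (-1 / τ) (z₁ / τ) (z₂ / τ) t =
      ∑ q ∈ Finset.range M ×ˢ Finset.range M,
        τ / M * exp (-(2 * Real.pi * I * ((m + 1 : ℕ) / M) *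
            ((half e + q.1 : ℚ) * k + (half e - q.2 : ℚ) * j))) *
          PsiTilde M m e' (half e + q.1) (half e - q.2) τ z₁ z₂ (t + z₁ * z₂ / τ) := by
  have hτ' := neg_one_div_im_pos hτ
  have hN := m.succ_pos
  have hj' : half e' + j = ((n + (e' : ℕ) : ℤ) : ℚ) := by
    rw [hj, Int.cast_add, ← two_mul_half]
    ring
  have hk' : half e' + k = ((n' + (e' : ℕ) : ℤ) : ℚ) := by
    rw [hk, Int.cast_add, ← two_mul_half]
    ring
  have hcoord : ∀ s : ℕ, (half e - s : ℚ) = half e + ((-1 * s : ℤ) : ℚ) := fun s => by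
    push_cast
    ring
  have hcoord' : ∀ s : ℕ, (half e + s : ℚ) = half e + ((1 * s : ℤ) : ℚ) := fun s => by
    push_cast
    ring
  rw [PsiTilde_eq hM m e j k hτ' (hz₁.neg_inv_add_latPt_ne_zero hτ M hj)
      (hz₂.neg_inv_add_latPt_ne_zero hτ M hk),
    psiHalf_neg_inv hM hN hgcd hj' hk' (σ := 1) (σ' := -1) (by norm_num) (by norm_num) hτ
      (hz₁.sub_add_latPt_ne_zero hj),
    psiHalf_neg_inv hM hN hgcd hk' hj' (σ := -1) (σ' := 1) (by norm_num) (by norm_num) hτ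
      (hz₂.sub_add_latPt_ne_zero hk), Finset.sum_comm (s := Finset.range M) (t := Finset.range M)
        (f := fun p s => exp (-(2 * Real.pi * I * ((m.succ : ℕ) / M) *
          ((half e + (-1 * p : ℤ) : ℚ) * j + (half e + (1 * s : ℤ) : ℚ) * k))) *
            psiHalf M m.succ (half e') (half e + (-1 * p : ℤ)) (half e + (1 * s : ℤ)) τ z₂ z₁),
    ← Finset.sum_product', ← Finset.sum_product', Finset.mul_sum, Finset.mul_sum,
    ← Finset.sum_add_distrib, Finset.mul_sum, Finset.mul_sum]
  refine Finset.sum_congr rfl fun q _ => ?_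
  rw [PsiTilde_eq hM m e' _ _ hτ (hz₁.add_latPt_ne_zero M (n := q.1) (by push_cast; rfl))
      (hz₂.add_latPt_ne_zero M (n := -q.2) (by push_cast; ring)), hcoord, hcoord',
    mul_comm z₂ z₁, mul_add (2 * Real.pi * I * ((m + 1 : ℕ) / M) : ℂ) t, exp_add,
    add_comm (((half e + ((-1 * (q.2 : ℤ) : ℤ) : ℚ) : ℚ) : ℂ) * j)]
  ring

/-! ### Differentiability of `Ψ̃` -/

theorem differentiableAt_psiHalf {M N : ℕ} (hM : 0 < M) (hN : 0 < N) (ε j k : ℚ) {τ : ℂ}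
    (hτ : 0 < τ.im) {z₁ : ℂ} (hz : ∀ p : ℤ × ℤ, z₁ + j * τ + ε + latPt (M * τ) 1 p ≠ 0) (z₂ : ℂ) :
    DifferentiableAt ℝ (fun q : ℂ × ℂ => psiHalf M N ε j k τ q.1 q.2) (z₁, z₂) := by
  have hMτ : 0 < (M * τ : ℂ).im := by
    rw [natCast_mul_im]
    positivity
  simp only [psiHalf_eq hM N ε j k hτ]
  have hconj : DifferentiableAt ℝ (fun q : ℂ × ℂ => conj q.2) (z₁, z₂) :=
    (conjCLE.differentiable.comp differentiable_snd) _
  have hK := (differentiableAt_kernelSum hMτ (gaussParam_pos hM hN hτ) hz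
    (z₂ + k * τ + ε)).comp (z₁, z₂) (f := fun q : ℂ × ℂ => (q.1 + j * τ + ε, q.2 + k * τ + ε))
    (by fun_prop)
  have h1 : DifferentiableAt ℝ (fun q : ℂ × ℂ =>
      (j : ℂ) * ((τ * conj q.2 - conj τ * q.2) / (τ - conj τ))) (z₁, z₂) :=
    (((hconj.const_mul τ).sub (differentiableAt_snd.const_mul _)).mul_const _).const_mul _
  have h2 : DifferentiableAt ℝ (fun q : ℂ × ℂ =>
      (q.1 + ε) * ((q.2 - conj q.2) / (τ - conj τ))) (z₁, z₂) :=
    (differentiableAt_fst.add_const _).mul ((differentiableAt_snd.sub hconj).mul_const _)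
  exact (((h1.sub h2).sub_const _).const_mul _).cexp.mul hK

theorem differentiableAt_PsiTilde {M : ℕ} (hM : 0 < M) (m : ℕ) (e : Fin 2) (j k : ℚ) {τ : ℂ}
    (hτ : 0 < τ.im) {z₁ z₂ : ℂ}
    (hz₁ : ∀ p : ℤ × ℤ, z₁ + j * τ + (half e : ℂ) + latPt (M * τ) 1 p ≠ 0)
    (hz₂ : ∀ p : ℤ × ℤ, z₂ + k * τ + (half e : ℂ) + latPt (M * τ) 1 p ≠ 0) (t : ℂ) :
    DifferentiableAt ℝ (fun p : ℂ × ℂ × ℂ => PsiTilde M m e j k τ p.1 p.2.1 p.2.2)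
      (z₁, z₂, t) := by
  have hMτ : 0 < (M * τ : ℂ).im := by
    rw [natCast_mul_im]
    positivity
  have hev : ∀ {z : ℂ} {a : ℚ}, (∀ p : ℤ × ℤ, z + a * τ + (half e : ℂ) + latPt (M * τ) 1 p ≠ 0) →
      ∀ᶠ z' in nhds z, ∀ p : ℤ × ℤ, z' + a * τ + (half e : ℂ) + latPt (M * τ) 1 p ≠ 0 :=
    fun {z a} hz => ((continuous_id.add continuous_const).add continuous_const).tendsto z |>.eventually
      (eventually_add_latPt_ne_zero hMτ hz)
  have h1 : ∀ᶠ p : ℂ × ℂ × ℂ in nhds (z₁, z₂, t), PsiTilde M m e j k τ p.1 p.2.1 p.2.2 =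
      exp (2 * Real.pi * I * ((m + 1 : ℕ) / M) * p.2.2) * (-(1 / (2 * Real.pi * I)) *
        (psiHalf M (m + 1) (half e) j k τ p.1 p.2.1 +
          psiHalf M (m + 1) (half e) k j τ p.2.1 p.1)) := by
    filter_upwards [(continuous_fst.tendsto (z₁, z₂, t)).eventually (hev hz₁),
      ((continuous_fst.comp continuous_snd).tendsto (z₁, z₂, t)).eventually (hev hz₂)] with p hp hp'
    exact PsiTilde_eq hM m e j k hτ hp hp' p.2.2
  refine DifferentiableAt.congr_of_eventuallyEq ?_ h1
  have h2 := (differentiableAt_psiHalf hM m.succ_pos (half e) j k hτ hz₁ z₂).comp (z₁, z₂, t)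
    (f := fun p : ℂ × ℂ × ℂ => (p.1, p.2.1)) (by fun_prop)
  have h3 := (differentiableAt_psiHalf hM m.succ_pos (half e) k j hτ hz₂ z₁).comp (z₁, z₂, t)
    (f := fun p : ℂ × ℂ × ℂ => (p.2.1, p.1)) (by fun_prop)
  have h4 : DifferentiableAt ℝ (fun p : ℂ × ℂ × ℂ =>
      exp (2 * Real.pi * I * ((m + 1 : ℕ) / M) * p.2.2)) (z₁, z₂, t) := by fun_prop
  exact h4.mul ((h2.add h3).const_mul _)

/-! ### The Wirtinger differential -/

section Wirtinger

variable {E E' : Type*} [NormedAddCommGroup E] [NormedSpace ℂ E] [NormedAddCommGroup E']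
  [NormedSpace ℂ E']

/-- The complex linear part of the real differential of `F`. -/
noncomputable def wirtinger (F : E → ℂ) (p v : E) : ℂ :=
  1 / 2 * (fderiv ℝ F p v - I * fderiv ℝ F p (I • v))

theorem wirtinger_add (F : E → ℂ) (p v v' : E) :
    wirtinger F p (v + v') = wirtinger F p v + wirtinger F p v' := by
  simp only [wirtinger, smul_add, map_add]
  ring

/-- For any real linear L, the map v ↦ L(v) − iL(iv) is complex linear. -/
theorem wirtinger_smul (F : E → ℂ) (p : E) (c : ℂ) (v : E) :
    wirtinger F p (c • v) = c * wirtinger F p v := by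
  have h : ∀ (x y : ℝ) (w : E), fderiv ℝ F p ((x + y * I : ℂ) • w) =
      x * fderiv ℝ F p w + y * fderiv ℝ F p (I • w) := fun x y w => by
    rw [add_smul, mul_smul, map_add, coe_smul, coe_smul, map_smul, map_smul, real_smul, real_smul]
  rw [wirtinger, wirtinger, ← re_add_im c, h, smul_smul,
    show I * (c.re + c.im * I : ℂ) = ((-c.im : ℝ) : ℂ) + (c.re : ℝ) * I by
      push_cast
      linear_combination (c.im : ℂ) * I_sq, h]
  push_cast
  linear_combination ((c.im : ℂ) * (1 / 2) * fderiv ℝ F p (I • v)) * I_sq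

/-- A complex linear h' commutes with multiplication by i, so the chain rule creates no
antiholomorphic terms even though the functions themselves are not holomorphic. -/
theorem wirtinger_sum_comp {ι : Type*} {s : Finset ι} {c : ι → ℂ} {F : E → ℂ} {G : ι → E' → ℂ}
    {h : E → E'} {h' : E →L[ℂ] E'} {p : E} (hh : HasFDerivAt h h' p)
    (hG : ∀ i ∈ s, DifferentiableAt ℝ (G i) (h p))
    (hF : ∀ᶠ q in nhds p, F q = ∑ i ∈ s, c i * G i (h q)) (v : E) :
    wirtinger F p v = ∑ i ∈ s, c i * wirtinger (G i) (h p) (h' v) := by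
  have hd : HasFDerivAt F (∑ i ∈ s, c i • (fderiv ℝ (G i) (h p)).comp (h'.restrictScalars ℝ)) p := by
    refine HasFDerivAt.congr_of_eventuallyEq ?_ hF
    exact HasFDerivAt.fun_sum fun i hi =>
      ((hG i hi).hasFDerivAt.comp p (hh.restrictScalars ℝ)).const_mul (c i)
  simp only [wirtinger, hd.fderiv, sum_apply]
  rw [Finset.mul_sum, ← Finset.sum_sub_distrib, Finset.mul_sum]
  refine Finset.sum_congr rfl fun i _ => ?_
  simp
  ring

end Wirtinger

theorem D₁_eq_wirtinger {F : ℂ → ℂ → ℂ → ℂ → ℂ} {τ z₁ z₂ t : ℂ}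
    (hF : DifferentiableAt ℝ (fun p : ℂ × ℂ × ℂ => F τ p.1 p.2.1 p.2.2) (z₁, z₂, t)) :
    D₁ F τ z₁ z₂ t = 1 / (2 * Real.pi * I) *
      wirtinger (fun p : ℂ × ℂ × ℂ => F τ p.1 p.2.1 p.2.2) (z₁, z₂, t)
        (1, -1, -((z₁ - z₂) / (2 * τ))) := by
  have h1 : dz (fun w => F τ w z₂ t) z₁ =
      wirtinger (fun p : ℂ × ℂ × ℂ => F τ p.1 p.2.1 p.2.2) (z₁, z₂, t) (1, 0, 0) := by
    have hi : HasFDerivAt (fun w : ℂ => (w, z₂, t)) (.inl ℝ ℂ (ℂ × ℂ)) z₁ :=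
      hasFDerivAt_prodMk_left z₁ (z₂, t)
    have := (HasFDerivAt.comp z₁ (f := fun w : ℂ => (w, z₂, t)) hF.hasFDerivAt hi).fderiv
    rw [dz, show (fun w => F τ w z₂ t) =
      (fun p : ℂ × ℂ × ℂ => F τ p.1 p.2.1 p.2.2) ∘ fun w => (w, z₂, t) from rfl, this]
    simp [wirtinger]
    rfl
  have h2 : dz (fun w => F τ z₁ w t) z₂ =
      wirtinger (fun p : ℂ × ℂ × ℂ => F τ p.1 p.2.1 p.2.2) (z₁, z₂, t) (0, 1, 0) := by
    have hi : HasFDerivAt (fun w : ℂ => (z₁, w, t))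
        ((ContinuousLinearMap.inr ℝ ℂ (ℂ × ℂ)).comp (.inl ℝ ℂ ℂ)) z₂ :=
      (hasFDerivAt_prodMk_right z₁ (z₂, t)).comp z₂ (f := fun w : ℂ => (w, t))
        (hasFDerivAt_prodMk_left z₂ t)
    have := (HasFDerivAt.comp z₂ (f := fun w : ℂ => (z₁, w, t)) hF.hasFDerivAt hi).fderiv
    rw [dz, show (fun w => F τ z₁ w t) =
      (fun p : ℂ × ℂ × ℂ => F τ p.1 p.2.1 p.2.2) ∘ fun w => (z₁, w, t) from rfl,
      this]
    simp [wirtinger]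
  have h3 : dz (fun w => F τ z₁ z₂ w) t =
      wirtinger (fun p : ℂ × ℂ × ℂ => F τ p.1 p.2.1 p.2.2) (z₁, z₂, t) (0, 0, 1) := by
    have hi : HasFDerivAt (fun w : ℂ => (z₁, z₂, w))
        ((ContinuousLinearMap.inr ℝ ℂ (ℂ × ℂ)).comp (.inr ℝ ℂ ℂ)) t :=
      (hasFDerivAt_prodMk_right z₁ (z₂, t)).comp t (f := fun w : ℂ => (z₂, w))
        (hasFDerivAt_prodMk_right z₂ t)
    have := (HasFDerivAt.comp t (f := fun w : ℂ => (z₁, z₂, w)) hF.hasFDerivAt hi).fderiv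
    rw [dz, show (fun w => F τ z₁ z₂ w) =
      (fun p : ℂ × ℂ × ℂ => F τ p.1 p.2.1 p.2.2) ∘ fun w => (z₁, z₂, w) from rfl,
      this]
    simp [wirtinger]
  have hv : ((1, -1, -((z₁ - z₂) / (2 * τ))) : ℂ × ℂ × ℂ) =
      (1, 0, 0) + ((-1 : ℂ) • (0, 1, 0) + (-((z₁ - z₂) / (2 * τ))) • (0, 0, 1)) := by
    ext <;> simp
  rw [D₁, h1, h2, h3, hv, wirtinger_add, wirtinger_add, wirtinger_smul, wirtinger_smul]
  ring

theorem D₁_congr_const_mul {F G : ℂ → ℂ → ℂ → ℂ → ℂ} {τ z₁ z₂ t c : ℂ}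
    (hF : DifferentiableAt ℝ (fun p : ℂ × ℂ × ℂ => F τ p.1 p.2.1 p.2.2) (z₁, z₂, t))
    (hG : DifferentiableAt ℝ (fun p : ℂ × ℂ × ℂ => G τ p.1 p.2.1 p.2.2) (z₁, z₂, t))
    (hFG : ∀ᶠ p : ℂ × ℂ × ℂ in nhds (z₁, z₂, t),
      F τ p.1 p.2.1 p.2.2 = c * G τ p.1 p.2.1 p.2.2) :
    D₁ F τ z₁ z₂ t = c * D₁ G τ z₁ z₂ t := by
  rw [D₁_eq_wirtinger hF, D₁_eq_wirtinger hG, wirtinger_sum_comp (s := {()}) (c := fun _ => c)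
    (G := fun _ p => G τ p.1 p.2.1 p.2.2) (hasFDerivAt_id _) (fun _ _ => hG)
    (by simpa using hFG)]
  simp
  ring

/-- Real differentiability of the summands at regular points. -/
theorem OffLattice.differentiableAt_PsiTilde {M : ℕ} (hM : 0 < M) (m : ℕ) {e e' : Fin 2} {a b : ℚ}
    {n n' : ℤ} (ha : a = half e + n) (hb : b = half e + n') {τ : ℂ} (hτ : 0 < τ.im) {z₁ z₂ : ℂ}
    (hz₁ : OffLattice e' e τ z₁) (hz₂ : OffLattice e' e τ z₂) (t : ℂ) :
    DifferentiableAt ℝ (fun p : ℂ × ℂ × ℂ => PsiTilde M m e' a b τ p.1 p.2.1 p.2.2) (z₁, z₂, t) :=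
  MockA11.differentiableAt_PsiTilde hM m e' a b hτ (hz₁.add_latPt_ne_zero M ha)
    (hz₂.add_latPt_ne_zero M hb) t

theorem D₁_PsiTilde_add_mul {M : ℕ} (hM : 0 < M) (m : ℕ) {e e' : Fin 2} {a b : ℚ} {x y : ℤ}
    (ha : a = half e + x) (hb : b = half e + y) (n n' : ℤ) {τ : ℂ} (hτ : 0 < τ.im) {z₁ z₂ : ℂ}
    (hz₁ : OffLattice e' e τ z₁) (hz₂ : OffLattice e' e τ z₂) (t : ℂ) :
    D₁ (PsiTilde M m e' (a + n * M) (b + n' * M)) τ z₁ z₂ t =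
      exp (-(2 * Real.pi * I * (m + 1 : ℕ) * half e' * (n + n'))) *
        D₁ (PsiTilde M m e' a b) τ z₁ z₂ t := by
  have ha' : a + n * M = half e + ((x + n * M : ℤ) : ℚ) := by
    rw [ha]
    push_cast
    ring
  have hb' : b + n' * M = half e + ((y + n' * M : ℤ) : ℚ) := by
    rw [hb]
    push_cast
    ring
  refine D₁_congr_const_mul (hz₁.differentiableAt_PsiTilde hM m ha' hb' hτ hz₂ t)
    (hz₁.differentiableAt_PsiTilde hM m ha hb hτ hz₂ t) ?_
  filter_upwards [(continuous_fst.tendsto (z₁, z₂, t)).eventually (hz₁.eventually hτ),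
    ((continuous_fst.comp continuous_snd).tendsto (z₁, z₂, t)).eventually (hz₂.eventually hτ)]
    with p hp (hp' : OffLattice e' e τ p.2.1)
  rw [PsiTilde_eq hM m e' _ _ hτ (hp.add_latPt_ne_zero M ha') (hp'.add_latPt_ne_zero M hb'),
    PsiTilde_eq hM m e' _ _ hτ (hp.add_latPt_ne_zero M ha) (hp'.add_latPt_ne_zero M hb),
    psiHalf_add_mul hM _ _ _ _ _ _ hτ, psiHalf_add_mul hM _ _ _ _ _ _ hτ, add_comm (n' : ℂ)]
  ring

/-- At (z₁/τ, z₂/τ) and parameter −1/τ the direction of D₁ is (1, −1, (z₁−z₂)/2). The differential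
of h sends it to (τ, −τ, −(z₁−z₂)/2), which is τ times the direction at parameter τ. The ∂/∂t term
of D₁ is what makes this work. -/
theorem D₁_PsiTilde_neg_inv {M m : ℕ} (hM : 0 < M) (hgcd : Nat.gcd M (m + 1) = 1) {e e' : Fin 2}
    {j k : ℚ} {n n' : ℤ} (hj : j = half e' + n) (hk : k = half e' + n') {τ : ℂ} (hτ : 0 < τ.im)
    {z₁ z₂ : ℂ} (hz₁ : OffLattice e' e τ z₁) (hz₂ : OffLattice e' e τ z₂) (t : ℂ) :
    D₁ (PsiTilde M m e j k) (-1 / τ) (z₁ / τ) (z₂ / τ) (t - z₁ * z₂ / τ) =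
      ∑ q ∈ Finset.range M ×ˢ Finset.range M,
        τ / M * exp (-(2 * Real.pi * I * ((m + 1 : ℕ) / M) *
            ((half e + q.1 : ℚ) * k + (half e - q.2 : ℚ) * j))) *
          (τ * D₁ (PsiTilde M m e' (half e + q.1) (half e - q.2)) τ z₁ z₂ t) := by
  have hτ0 : τ ≠ 0 := fun h => by simp [h] at hτ
  have hτ' := neg_one_div_im_pos hτ
  set h : ℂ × ℂ × ℂ → ℂ × ℂ × ℂ := fun q => (τ * q.1, τ * q.2.1, q.2.2 + τ * (q.1 * q.2.1)) with hh
  set p : ℂ × ℂ × ℂ := (z₁ / τ, z₂ / τ, t - z₁ * z₂ / τ) with hp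
  have hhp : h p = (z₁, z₂, t) := by
    simp only [hh, hp]
    ext
    · field_simp
    · field_simp
    · field_simp
      ring
  have hG : ∀ q : ℕ × ℕ, DifferentiableAt ℝ (fun p : ℂ × ℂ × ℂ =>
      PsiTilde M m e' (half e + q.1) (half e - q.2) τ p.1 p.2.1 p.2.2) (z₁, z₂, t) := fun q =>
    hz₁.differentiableAt_PsiTilde hM m (n := q.1) (n' := -q.2) (by push_cast; rfl)
      (by push_cast; ring) hτ hz₂ t
  have hfst : HasFDerivAt (fun q : ℂ × ℂ × ℂ => q.1) (.fst ℂ ℂ (ℂ × ℂ)) p := hasFDerivAt_fst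
  have hsnd : HasFDerivAt (fun q : ℂ × ℂ × ℂ => q.2.1)
      ((ContinuousLinearMap.fst ℂ ℂ ℂ).comp (.snd ℂ ℂ (ℂ × ℂ))) p :=
    hasFDerivAt_fst.comp p hasFDerivAt_snd
  have hthd : HasFDerivAt (fun q : ℂ × ℂ × ℂ => q.2.2)
      ((ContinuousLinearMap.snd ℂ ℂ ℂ).comp (.snd ℂ ℂ (ℂ × ℂ))) p :=
    hasFDerivAt_snd.comp p hasFDerivAt_snd
  have hder := (hfst.const_mul τ).prodMk ((hsnd.const_mul τ).prodMk
    (hthd.add ((hfst.mul hsnd).const_mul τ)))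
  rw [D₁_eq_wirtinger (MockA11.differentiableAt_PsiTilde hM m e j k hτ'
      (hz₁.neg_inv_add_latPt_ne_zero hτ M hj) (hz₂.neg_inv_add_latPt_ne_zero hτ M hk) _),
    wirtinger_sum_comp (s := Finset.range M ×ˢ Finset.range M) (h := h)
      (c := fun q => τ / M * exp (-(2 * Real.pi * I * ((m + 1 : ℕ) / M) *
            ((half e + q.1 : ℚ) * k + (half e - q.2 : ℚ) * j))))
      (G := fun q p => PsiTilde M m e' (half e + q.1) (half e - q.2) τ p.1 p.2.1 p.2.2)
      hder (fun q _ => by rw [hhp]; exact hG q) ?_, Finset.mul_sum]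
  · refine Finset.sum_congr rfl fun q _ => ?_
    have hv : ((1 : ℂ), (-1 : ℂ), -((z₁ / τ - z₂ / τ) / (2 * (-1 / τ)))) = (1, -1, (z₁ - z₂) / 2) := by
      ext
      · rfl
      · rfl
      · field_simp
    rw [D₁_eq_wirtinger (hG q), hv, hhp, mul_left_comm τ, ← wirtinger_smul _ _ τ, mul_left_comm]
    congr 3
    ext
    · simp
    · simp
    · simp [hp]
      field_simp
      ring
  · have hev : ∀ {z : ℂ}, OffLattice e' e τ z → ∀ᶠ w in nhds (z / τ), OffLattice e' e τ (τ * w) :=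
      fun {z} hz => ((continuous_const.mul continuous_id).tendsto (z / τ)).eventually (by
        simpa [mul_div_cancel₀ _ hτ0] using hz.eventually hτ)
    filter_upwards [(continuous_fst.tendsto p).eventually (hev hz₁),
      ((continuous_fst.comp continuous_snd).tendsto p).eventually (hev hz₂)] with q hq
      (hq' : OffLattice e' e τ (τ * q.2.1))
    have h1 := PsiTilde_neg_inv hM hgcd hj hk hτ hq hq' q.2.2
    rw [mul_div_cancel_left₀ _ hτ0, mul_div_cancel_left₀ _ hτ0] at h1
    rw [h1]
    refine Finset.sum_congr rfl fun _ _ => ?_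
    simp only [hh]
    congr 2
    field_simp

/-! ### Assembly of the transformation formula -/

theorem sum_Omega (M : ℕ) (e : Fin 2) (f : ℚ × ℚ → ℂ) :
    ∑ p ∈ Omega M e, f p = ∑ q ∈ Finset.range M ×ˢ Finset.range M,
      f ((q.1 : ℚ) + half e, (q.2 : ℚ) - half e) := by
  rw [Omega, Finset.sum_image]
  rintro ⟨a, b⟩ - ⟨a', b'⟩ - h
  simp only [Prod.mk.injEq, add_left_inj, sub_left_inj, Nat.cast_inj] at h
  exact Prod.ext h.1 h.2

end MockA11

theorem theorem8p7 (M m : ℕ) (hM : 0 < M) (hm : 0 < m)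
    (hgcd : 1 < m → Nat.gcd M (2 * m) = 1)
    (e e' : Fin 2) (j k : ℚ) (hjk : (j, k) ∈ MockA11.Omega M e')
    (τ z₁ z₂ t : ℂ) (hτ : 0 < τ.im) (hreg : MockA11.IsRegularPoint e' e τ z₁ z₂) :
    -- the functions to which `D₁` is applied are real differentiable in `(z₁, z₂, t)`
    (∀ a b : ℤ, DifferentiableAt ℝ
      (fun p : ℂ × ℂ × ℂ =>
        MockA11.PsiTilde M (m - 1) e' (MockA11.half e + a) (-(MockA11.half e + b))
          τ p.1 p.2.1 p.2.2) (z₁, z₂, -t)) ∧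
    -- the summands depend only on `a` and `b` modulo `M`
    (∀ a b a' b' : ℚ, (∃ n : ℤ, a = MockA11.half e + n) → (∃ n : ℤ, b = MockA11.half e + n) →
      (∃ n : ℤ, a' = a + n * M) → (∃ n : ℤ, b' = b + n * M) →
      Complex.exp (2 * Real.pi * Complex.I * m / M * (a' * k + b' * j)) *
          MockA11.modChar M m e' e a' b' τ z₁ z₂ t =
        Complex.exp (2 * Real.pi * Complex.I * m / M * (a * k + b * j)) *
          MockA11.modChar M m e' e a b τ z₁ z₂ t) ∧
    -- the transformation formula, with `Ω_ε` as system of representatives of `(ε + ℤ/Mℤ)²`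
    MockA11.modChar M m e e' j k (-1 / τ) (z₁ / τ) (z₂ / τ) (t + z₁ * z₂ / τ) =
      (-1 : ℂ) ^ (((e : ℕ) : ℤ) - ((e' : ℕ) : ℤ)) * (τ / (Complex.I * M)) *
        ∑ p ∈ MockA11.Omega M e,
          Complex.exp (2 * Real.pi * Complex.I * m / M * (p.1 * k + p.2 * j)) *
            MockA11.modChar M m e' e p.1 p.2 τ z₁ z₂ t := by
  have hMc : (M : ℂ) ≠ 0 := by exact_mod_cast hM.ne'
  have hτ0 : τ ≠ 0 := fun h => by simp [h] at hτ
  obtain ⟨m, rfl⟩ : ∃ m', m = m' + 1 := ⟨m - 1, by omega⟩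
  have hgcd' : Nat.gcd M (m + 1) = 1 := by
    rcases Nat.eq_zero_or_pos m with rfl | h
    · simp
    · exact Nat.Coprime.coprime_mul_left_right (hgcd (by omega))
  obtain ⟨⟨x, hx⟩, ⟨y, hy⟩, -⟩ := (MockA11.mem_Omega M e' j k).mp hjk
  have hz₁ : MockA11.OffLattice e' e τ z₁ := fun r s => (hreg r s).1
  have hz₂ : MockA11.OffLattice e' e τ z₂ := fun r s => (hreg r s).2.1
  -- The characters use Ψ̃ at −b, which lies in the same class ε + ℤ because 2ε is an integer.
  have hneg : ∀ {f : Fin 2} {b : ℚ} {n : ℤ}, b = MockA11.half f + n →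
      -b = MockA11.half f + ((-n - (f : ℕ) : ℤ) : ℚ) := fun {f b n} hb => by
    have := MockA11.two_mul_half f
    rw [hb]
    push_cast at this ⊢
    linear_combination -this
  rw [Nat.add_sub_cancel]
  refine ⟨fun a b => hz₁.differentiableAt_PsiTilde hM m rfl (hneg rfl) hτ hz₂ _, ?_, ?_⟩
  · rintro a b _ _ ⟨u, ha⟩ ⟨v, hb⟩ ⟨n, rfl⟩ ⟨n', rfl⟩
    have hshift : -(b + n' * M) = -b + ((-n' : ℤ) : ℚ) * M := by
      push_cast
      ring
    rw [MockA11.modChar, MockA11.modChar, Nat.add_sub_cancel, hshift,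
      MockA11.D₁_PsiTilde_add_mul hM m ha (hneg hb) _ _ hτ hz₁ hz₂, ← mul_div_assoc,
      ← mul_div_assoc, ← mul_assoc, ← Complex.exp_add]
    congr 2
    rw [Complex.exp_eq_exp_iff_exists_int]
    -- With k = ε' + y and j = ε' + x, the phase change (m+1)(nk + n'j) minus the multiplier
    -- (m+1)ε'(n − n') of Ψ̃ is this integer, since 2ε' = e'.
    refine ⟨(m + 1) * (n * y + n' * (x + (e' : ℕ))), ?_⟩
    have h2 : (2 * MockA11.half e' : ℂ) = ((e' : ℕ) : ℤ) := by
      exact_mod_cast MockA11.two_mul_half e'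
    rw [hx, hy]
    push_cast at h2 ⊢
    field_simp
    linear_combination (M : ℂ) * n' * h2
  · rw [MockA11.modChar, Nat.add_sub_cancel, MockA11.Rhat_neg_inv e e' hτ,
      show -(t + z₁ * z₂ / τ) = -t - z₁ * z₂ / τ by ring,
      MockA11.D₁_PsiTilde_neg_inv hM hgcd' hx (hneg hy) hτ hz₁ hz₂, MockA11.sum_Omega,
      Finset.mul_sum, Finset.sum_div]
    refine Finset.sum_congr rfl fun q _ => ?_
    have hsign : (-1 : ℂ) ^ (((e : ℕ) : ℤ) - ((e' : ℕ) : ℤ)) =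
        ((-1) ^ (e : ℕ) * (-1) ^ (e' : ℕ))⁻¹ := by
      fin_cases e <;> fin_cases e' <;> norm_num
    -- The representatives b = s − ε of `Omega` give −b = ε − s, matching the downward enumeration
    -- of the second index.
    have hphase : Complex.exp (-(2 * Real.pi * Complex.I * ((m + 1 : ℕ) / M) *
          ((MockA11.half e + q.1 : ℚ) * (-k : ℚ) + (MockA11.half e - q.2 : ℚ) * j))) =
        Complex.exp (2 * Real.pi * Complex.I * (m + 1 : ℕ) / M *
          (((q.1 : ℚ) + MockA11.half e : ℚ) * k + ((q.2 : ℚ) - MockA11.half e : ℚ) * j)) := by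
      congr 1
      push_cast
      ring
    rw [hphase, MockA11.modChar, Nat.add_sub_cancel, hsign, neg_sub, add_comm (MockA11.half e)]
    have hs : ((-1 : ℂ) ^ (e : ℕ) * (-1) ^ (e' : ℕ)) ≠ 0 := by simp
    generalize ((-1 : ℂ) ^ (e : ℕ) * (-1) ^ (e' : ℕ)) = s at hs ⊢
    have hI := Complex.I_ne_zero
    rw [← div_div _ (s * (Complex.I * τ))]
    simp only [← mul_div_assoc]
    congr 1
    field_simp
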